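/- **Setting.** Fix $n\ge 2$ and a probability space. Let $\beta=(\beta(1),\beta(2),\dots)$ be a random sequence, $X=(X_1,\dots,X_n)$ a random vector and $Z=(Z_{ij})_{i\ge 1,\,1\le j\le n}$ a random array such that 1. the $\beta(i)$ are uniformly bounded independent random variables, and almost surely $\mu_p(\beta)=\frac1p\sum_{i\le p}\beta(i)$ and $d_p(\beta)=\Big(\frac1p\sum_{i\le p}\big(\frac{\beta(i)-\mu_p(\beta)}{\mu_p(\beta)}\big)^2\Big)^{1/2}$ converge, as $p\to\infty$, to limits in $(0,\infty)$; 2. $\beta$, $X$, $Z$ are jointly independent; 3. the $X_j$ are iid with mean zero and variance $\sigma^2$; 4. the $Z_{ij}$ have mean zero, common variance $\delta^2\in(0,\infty)$ and uniformly bounded fourth moments; the rows $(Z_{i1},\dots,Z_{in})$ are mutually independent, and the entries of each row are pairwise uncorrelated. For each $p$ let $\beta^p=(\beta(1),\dots,\beta(p))$, let $Z^p$ consist of the first $p$ rows of $Z$, and put $R^p=\beta^pX^T+Z^p\in\mathbb R^{p\times n}$, $b=\beta^p/\|\beta^p\|$ and $q=(1,\dots,1)/\sqrt p\in\mathbb R^p$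 (Euclidean norms throughout). Let $s_p^2$ be the largest eigenvalue of $\frac1nR^p(R^p)^T$, let $h$ be a unit eigenvector for $s_p^2$ with $(h,q)\ge 0$ (the PCA estimator), let $\ell_p^2=\frac{1}{n-1}\big(\operatorname{tr}(\tfrac1nR^p(R^p)^T)-s_p^2\big)$ (the average of the $n-1$ remaining possibly nonzero eigenvalues), and let $\psi_p=\sqrt{(s_p^2-\ell_p^2)/s_p^2}$. For a subspace $L\subseteq\mathbb R^p$ the MAPS estimator is $$\hat h_L=\frac{\tau_p h+\operatorname{proj}_L h}{\|\tau_p h+\operatorname{proj}_L h\|},\qquad \tau_p=\frac{\psi_p^2-\|\operatorname{proj}_L h\|^2}{1-\psi_p^2},$$ and $\hat h_q=\hat h_{\operatorname{span}\{q\}}$ is the GPS estimator. A random linear subspace of $\mathbb R^p$ of dimension $k_p$, $1\le k_p\le p-1$, is $\operatorname{span}\{\xi^pe_1,\dots,\xi^pe_{k_p}\}$ with $\xi^p$ an $O(p)$-valued random variable and $e_i$ the standard basis; it is independent of a random variable if $\xi^p$ is, and it is a Haar random subspace if $\xi^p$ is distributed according to Haar measure on $O(p)$. A non-decreasing sequence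 of positive integers $k_p$ is square root dominated if $\sum_{p\ge1}k_p^2/p^2<\infty$. **Theorem 2.1.** For each $p\ge 2$ let $L_p$ be a random linear subspace and $H_p$ a Haar random subspace of $\mathbb R^p$, each of them independent of $\beta$ and independent of $Z$, such that the sequences $\dim L_p$ and $\dim H_p$ are square root dominated. Let $L_p'=\operatorname{span}\{L_p,q\}$ and $L_p''=\operatorname{span}\{H_p,q\}$. Then, almost surely on the event $\{X\ne 0\}$ (hence almost surely if $\mathbb P(X=0)=0$), the limits $\|\hat h_q-b\|_\infty=\lim_{p\to\infty}\|\hat h_q-b\|$ and $\|h-b\|_\infty=\lim_{p\to\infty}\|h-b\|$ exist, and (a) $\limsup_{p\to\infty}\|\hat h_{L'_p}-b\|\le\|\hat h_q-b\|_\infty$; (b) $\lim_{p\to\infty}\|\hat h_{L''_p}-b\|=\|\hat h_q-b\|_\infty$; (c) $\lim_{p\to\infty}\|\hat h_{H_p}-b\|=\|h-b\|_\infty$. -/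

import Mathlib

open MeasureTheory ProbabilityTheory Filter Topology

noncomputable section

namespace MAPS

/-! ### The one-factor model and the sample covariance matrix

Asset `i` of the text (`i = 1, 2, …`) is index `i - 1` here. The definitions of this part are
deterministic; they are applied to the realisations of the random objects. -/

/-- The truncation `β^p = (β(1), …, β(p))`. -/
def betaVec (β : ℕ → ℝ) (p : ℕ) : EuclideanSpace ℝ (Fin p) :=
  WithLp.toLp 2 (fun i => β i)

/-- The normalised vector `b = β^p / ‖β^p‖`. -/
def bVec (β : ℕ → ℝ) (p : ℕ) : EuclideanSpace ℝ (Fin p) :=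
  ‖betaVec β p‖⁻¹ • betaVec β p

/-- The unit vector `q = (1, …, 1) / √p`. -/
def qVec (p : ℕ) : EuclideanSpace ℝ (Fin p) :=
  WithLp.toLp 2 (fun _ => (Real.sqrt p)⁻¹)

/-- The mean `μ_p(β)`. -/
def mean (β : ℕ → ℝ) (p : ℕ) : ℝ :=
  (∑ i ∈ Finset.range p, β i) / p

/-- The dispersion `d_p(β)`, the nonnegative root of
`d_p(β)² = (1/p) ∑ ((β(i) - μ_p(β)) / μ_p(β))²`. -/
def dispersion (β : ℕ → ℝ) (p : ℕ) : ℝ :=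
  Real.sqrt ((∑ i ∈ Finset.range p, ((β i - mean β p) / mean β p) ^ 2) / p)

/-- The `p × n` matrix of returns `R^p = β^p Xᵀ + Z^p`. -/
def returns {n : ℕ} (β : ℕ → ℝ) (X : Fin n → ℝ) (Z : ℕ → Fin n → ℝ) (p : ℕ) :
    Matrix (Fin p) (Fin n) ℝ :=
  Matrix.of fun i j => β i * X j + Z i j

/-- The sample covariance matrix `(1/n) R Rᵀ`. -/
def sampleCov {p n : ℕ} (R : Matrix (Fin p) (Fin n) ℝ) : Matrix (Fin p) (Fin p) ℝ :=
  (n : ℝ)⁻¹ • (R * R.transpose)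

theorem sampleCov_isHermitian {p n : ℕ} (R : Matrix (Fin p) (Fin n) ℝ) :
    (sampleCov R).IsHermitian := by
  unfold Matrix.IsHermitian sampleCov
  rw [Matrix.conjTranspose_eq_transpose_of_trivial, Matrix.transpose_smul,
    Matrix.transpose_mul, Matrix.transpose_transpose]

/-- `s²`, the largest eigenvalue of the sample covariance matrix. -/
def sSq {p n : ℕ} (R : Matrix (Fin p) (Fin n) ℝ) : ℝ :=
  ⨆ i, (sampleCov_isHermitian R).eigenvalues i

/-- `ℓ²`, the average of the remaining eigenvalues of the sample covariance matrix. Since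
`(1/n) R Rᵀ` has rank at most `n`, at most `n - 1` of the remaining eigenvalues are different
from zero, and the average is taken over these `n - 1` eigenvalues. -/
def lSq {p n : ℕ} (R : Matrix (Fin p) (Fin n) ℝ) : ℝ :=
  ((∑ i, (sampleCov_isHermitian R).eigenvalues i) - sSq R) / ((n : ℝ) - 1)

/-- `ψ = √((s² - ℓ²) / s²)`. -/
def psi {p n : ℕ} (R : Matrix (Fin p) (Fin n) ℝ) : ℝ :=
  Real.sqrt ((sSq R - lSq R) / sSq R)

/-- `h` is a PCA estimator for the data `R`: a unit leading eigenvector of the sample covariance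
matrix, with the sign chosen such that `(h, q) ≥ 0`. -/
structure IsPCA {p n : ℕ} (R : Matrix (Fin p) (Fin n) ℝ) (h : EuclideanSpace ℝ (Fin p)) :
    Prop where
  norm_eq_one : ‖h‖ = 1
  eigenvector : (sampleCov R).toEuclideanLin h = sSq R • h
  inner_nonneg : 0 ≤ inner ℝ h (qVec p)

/-- `τ = (ψ² - ‖proj_L h‖²) / (1 - ψ²)`. -/
def tau {p n : ℕ} (R : Matrix (Fin p) (Fin n) ℝ) (h : EuclideanSpace ℝ (Fin p))
    (L : Submodule ℝ (EuclideanSpace ℝ (Fin p))) : ℝ :=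
  (psi R ^ 2 - ‖L.starProjection h‖ ^ 2) / (1 - psi R ^ 2)

/-- The MAPS estimator `ĥ_L = (τ h + proj_L h) / ‖τ h + proj_L h‖`. -/
def maps {p n : ℕ} (R : Matrix (Fin p) (Fin n) ℝ) (h : EuclideanSpace ℝ (Fin p))
    (L : Submodule ℝ (EuclideanSpace ℝ (Fin p))) : EuclideanSpace ℝ (Fin p) :=
  ‖tau R h L • h + L.starProjection h‖⁻¹ • (tau R h L • h + L.starProjection h)

/-- The one-dimensional subspace spanned by `q`. -/
def qSpan (p : ℕ) : Submodule ℝ (EuclideanSpace ℝ (Fin p)) :=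
  Submodule.span ℝ {qVec p}

/-- The GPS estimator `ĥ_q`, the MAPS estimator of the subspace spanned by `q`. -/
def gps {p n : ℕ} (R : Matrix (Fin p) (Fin n) ℝ) (h : EuclideanSpace ℝ (Fin p)) :
    EuclideanSpace ℝ (Fin p) :=
  maps R h (qSpan p)

/-! ### Random subspaces -/

/-- The orthogonal group `O(p)` carries its Borel σ-algebra. -/
instance orthogonalGroupMeasurableSpace (p : ℕ) :
    MeasurableSpace (Matrix.orthogonalGroup (Fin p) ℝ) := borel _

instance orthogonalGroupBorelSpace (p : ℕ) :
    BorelSpace (Matrix.orthogonalGroup (Fin p) ℝ) := ⟨rfl⟩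

/-- The subspace `span {g e_i | i = 1, …, k}` of `ℝ^p` generated by `g ∈ O(p)`. -/
def subspaceOf {p : ℕ} (g : Matrix.orthogonalGroup (Fin p) ℝ) (k : ℕ) :
    Submodule ℝ (EuclideanSpace ℝ (Fin p)) :=
  Submodule.span ℝ {v | ∃ i : Fin p, (i : ℕ) < k ∧
    v = (g : Matrix (Fin p) (Fin p) ℝ).toEuclideanLin (EuclideanSpace.single i 1)}

/-- A non-decreasing sequence `k_1, k_2, …` of positive integers is square root dominated if
`∑ k_p² / p² < ∞`. (The value `k 0` plays no role: the term `p = 0` of the sum is `0`.) -/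
structure SquareRootDominated (k : ℕ → ℕ) : Prop where
  pos : ∀ p, 1 ≤ p → 0 < k p
  mono : MonotoneOn k (Set.Ici 1)
  summable : Summable fun p : ℕ => (k p : ℝ) ^ 2 / (p : ℝ) ^ 2

/-! ### The assumptions on `β`, `X` and `Z` -/

section Assumptions

variable {Ω : Type*} [MeasurableSpace Ω] {n : ℕ}

/-- Regularity of beta: uniformly bounded independent entries, and the mean and the dispersion
converge (almost surely) to limits in `(0, ∞)`. -/
structure RegularBeta (P : Measure Ω) (β : ℕ → Ω → ℝ) : Prop where
  measurable : ∀ i, Measurable (β i)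
  bounded : ∃ C : ℝ, ∀ i, ∀ᵐ ω ∂P, |β i ω| ≤ C
  indep : iIndepFun β P
  limits : ∀ᵐ ω ∂P, ∃ μ d : ℝ, 0 < μ ∧ 0 < d ∧
    Tendsto (fun p => mean (fun i => β i ω) p) atTop (𝓝 μ) ∧
    Tendsto (fun p => dispersion (fun i => β i ω) p) atTop (𝓝 d)

/-- `β`, `X` and `Z` are jointly independent of each other. -/
def JointlyIndependent (P : Measure Ω) (β : ℕ → Ω → ℝ) (X : Fin n → Ω → ℝ)
    (Z : ℕ → Fin n → Ω → ℝ) : Prop :=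
  iIndep ![MeasurableSpace.comap (fun ω i => β i ω) inferInstance,
    MeasurableSpace.comap (fun ω j => X j ω) inferInstance,
    MeasurableSpace.comap (fun ω i j => Z i j ω) inferInstance] P

/-- Regularity of `X`: iid entries with mean zero and variance `σ²`. -/
structure RegularX (P : Measure Ω) (X : Fin n → Ω → ℝ) (σ : ℝ) : Prop where
  measurable : ∀ j, Measurable (X j)
  indep : iIndepFun X P
  ident : ∀ j k, IdentDistrib (X j) (X k) P P
  memLp : ∀ j, MemLp (X j) 2 P
  mean_zero : ∀ j, ∫ ω, X j ω ∂P = 0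
  variance_eq : ∀ j, variance (X j) P = σ ^ 2

/-- Regularity of `Z`: entries with mean zero, variance `δ²` and uniformly bounded fourth moment;
the rows are mutually independent, and within each row the entries are pairwise uncorrelated. -/
structure RegularZ (P : Measure Ω) (Z : ℕ → Fin n → Ω → ℝ) (δ : ℝ) : Prop where
  measurable : ∀ i j, Measurable (Z i j)
  memLp : ∀ i j, MemLp (Z i j) 4 P
  mean_zero : ∀ i j, ∫ ω, Z i j ω ∂P = 0
  variance_eq : ∀ i j, variance (Z i j) P = δ ^ 2
  fourth_moment : ∃ M : ℝ, ∀ i j, ∫ ω, Z i j ω ^ 4 ∂P ≤ M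
  rows_indep : iIndepFun (fun (i : ℕ) (ω : Ω) (j : Fin n) => Z i j ω) P
  uncorrelated : ∀ i j k, j ≠ k → covariance (Z i j) (Z i k) P = 0

/-- The subspace of `ℝ^p` generated by the `O(p)`-valued random variable `ξ` is independent of
`β^p` and independent of `Z^p`. -/
structure IndependentOfBetaZ (P : Measure Ω) (β : ℕ → Ω → ℝ) (Z : ℕ → Fin n → Ω → ℝ) {p : ℕ}
    (ξ : Ω → Matrix.orthogonalGroup (Fin p) ℝ) : Prop where
  beta : IndepFun ξ (fun ω (i : Fin p) => β i ω) P
  noise : IndepFun ξ (fun ω (i : Fin p) (j : Fin n) => Z i j ω) P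

end Assumptions

end MAPS

end

open MAPS

/-! For large p the leading eigenvector is h ≈ √t b + noise, where t in (0, 1) is the limit of ψ²
and the noise is a linear combination of the n columns of Z^p divided by √p. This is read off the n
× n Gram matrix RᵀR/p, which converges to B XXᵀ + δ² I with B = lim ‖β^p‖²/p. Its leading eigenvalue
tends to B|X|² + δ², so t = B|X|² / (B|X|² + δ²); the condition (h, q) ≥ 0, together with lim μ_p >
0, fixes the sign of √t.

The noise does not vanish, but it is asymptotically orthogonal to b, and so is its projection to a
low-dimensional subspace K independent of Z: it tends to 0. Hence P_K h ≈ √t P_K b. With c = ‖P_K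
b‖², the squared cosine between the MAPS estimator and b is therefore close to (t + c - 2tc)/(1 -
tc) (`LimitLaws.tendsto_norm_maps_sub`). This function is increasing in c and equals t at c = 0. All
three claims follow: span{L, q} captures at least as much of b as span{q}, and a Haar subspace H
asymptotically captures neither b nor q, so adding it to q leaves the limit of c unchanged, while H
alone has c → 0 and performs like PCA.

Probability supplies only almost sure limits. The laws of large numbers come from second moments
(`ae_tendsto_average_of_orthogonal`). The small projections come from
`ae_tendsto_sum_sq_of_fourth_moment`: if k coordinates have fourth moments at most D/p², the second
moment of the sum of their squares is at most D k²/p², which square root domination makes summable.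
It is applied to the coordinates of Z_j/√p in a frame independent of Z, and to those of b and q in a
Haar frame. The rest, `LimitLaws.conclusion`, is deterministic, for a fixed realisation with X ≠ 0.
-/

open MAPS

/-! ### The limiting cosine as a function of t and c -/

/-- The squared asymptotic cosine between the MAPS estimator and `b`, when `ψ² → t` and
`‖proj_L b‖² → c`. -/
noncomputable def mapsCosSq (t c : ℝ) : ℝ := (t + c - 2 * t * c) / (1 - t * c)

theorem one_sub_mul_pos {t c : ℝ} (ht : 0 < t) (ht1 : t < 1) (hc : c ≤ 1) : 0 < 1 - t * c := by
  nlinarith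

/-- After cross-multiplication the two sides differ by (d - c)(1 - t)². This monotonicity is what
makes a larger target subspace at least as good. -/
theorem mapsCosSq_mono {t c d : ℝ} (ht : 0 < t) (ht1 : t < 1) (hcd : c ≤ d)
    (hd : d ≤ 1) : mapsCosSq t c ≤ mapsCosSq t d := by
  unfold mapsCosSq
  rw [div_le_div_iff₀ (one_sub_mul_pos ht ht1 (hcd.trans hd)) (one_sub_mul_pos ht ht1 hd)]
  nlinarith [mul_nonneg (sub_nonneg.2 hcd) (sq_nonneg (1 - t))]

theorem mapsCosSq_zero (t : ℝ) : mapsCosSq t 0 = t := by simp [mapsCosSq]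

theorem mapsCosSq_pos {t c : ℝ} (ht : 0 < t) (ht1 : t < 1) (hc0 : 0 ≤ c) (hc : c ≤ 1) :
    0 < mapsCosSq t c :=
  lt_of_lt_of_le (by rwa [mapsCosSq_zero]) (mapsCosSq_mono ht ht1 hc0 hc)

theorem tendsto_mapsCosSq {ι : Type*} {l : Filter ι} {t c : ℝ} {u : ι → ℝ} (ht : 0 < t)
    (ht1 : t < 1) (hc : c ≤ 1) (hu : Tendsto u l (𝓝 c)) :
    Tendsto (fun p => mapsCosSq t (u p)) l (𝓝 (mapsCosSq t c)) := by
  unfold mapsCosSq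
  exact ((hu.const_add t).sub (hu.const_mul (2 * t))).div ((hu.const_mul t).const_sub 1)
    (one_sub_mul_pos ht ht1 hc).ne'

/-- The cosine `⟨τ h + P h, b⟩ / ‖τ h + P h‖` in terms of `τ = (x - a) / (1 - x)`, `a = ‖P h‖²`,
`g = ⟨h, b⟩` and `f = ⟨P h, b⟩`. -/
noncomputable def mapsCos (x a g f : ℝ) : ℝ :=
  ((x - a) / (1 - x) * g + f) / √(((x - a) / (1 - x)) ^ 2 + 2 * ((x - a) / (1 - x)) * a + a)

theorem tendsto_mapsCos {ι : Type*} {l : Filter ι} {t c : ℝ} {x a g f : ι → ℝ}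
    (ht : 0 < t) (ht1 : t < 1) (hc0 : 0 ≤ c) (hc : c ≤ 1)
    (hx : Tendsto x l (𝓝 t)) (ha : Tendsto a l (𝓝 (t * c))) (hg : Tendsto g l (𝓝 √t))
    (hf : Tendsto f l (𝓝 (√t * c))) :
    Tendsto (fun p => mapsCos (x p) (a p) (g p) (f p)) l (𝓝 √(mapsCosSq t c)) := by
  have h1 : (1 - t) ≠ 0 := by linarith
  have hτ : Tendsto (fun p => (x p - a p) / (1 - x p)) l (𝓝 ((t - t * c) / (1 - t))) :=
    (hx.sub ha).div (hx.const_sub 1) h1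
  have hD : ((t - t * c) / (1 - t)) ^ 2 + 2 * ((t - t * c) / (1 - t)) * (t * c) + t * c
      = t * (t + c - 2 * t * c) * (1 - t * c) / (1 - t) ^ 2 := by
    field_simp; ring
  have hN : 0 < t + c - 2 * t * c := by
    have h3 := mapsCosSq_pos ht ht1 hc0 hc
    unfold mapsCosSq at h3
    exact (div_pos_iff_of_pos_right (one_sub_mul_pos ht ht1 hc)).1 h3
  have hDpos : 0 < ((t - t * c) / (1 - t)) ^ 2 + 2 * ((t - t * c) / (1 - t)) * (t * c) + t * c := by
    rw [hD]
    have := one_sub_mul_pos ht ht1 hc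
    have : 0 < 1 - t := by linarith
    positivity
  -- At the limit the numerator is √t (t + c - 2tc)/(1 - t) and the squared denominator is t (t + c
  -- - 2tc)(1 - tc)/(1 - t)².
  have key : √(mapsCosSq t c) = ((t - t * c) / (1 - t) * √t + √t * c) /
      √(((t - t * c) / (1 - t)) ^ 2 + 2 * ((t - t * c) / (1 - t)) * (t * c) + t * c) := by
    have h5 : (t - t * c) / (1 - t) * √t + √t * c = √t * ((t + c - 2 * t * c) / (1 - t)) := by
      field_simp; ring
    have h6 : 0 < 1 - t := by linarith
    rw [eq_div_iff (Real.sqrt_pos.2 hDpos).ne', ← Real.sqrt_mul (mapsCosSq_pos ht ht1 hc0 hc).le,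
      h5, hD]
    have h7 : √t * ((t + c - 2 * t * c) / (1 - t)) = √(t * ((t + c - 2 * t * c) / (1 - t)) ^ 2) := by
      rw [Real.sqrt_mul ht.le, Real.sqrt_sq (by positivity)]
    rw [h7]
    congr 1
    unfold mapsCosSq
    have := (one_sub_mul_pos ht ht1 hc).ne'
    field_simp
  rw [key]
  unfold mapsCos
  exact ((hτ.mul hg).add hf).div
    ((((hτ.pow 2).add ((hτ.const_mul 2).mul ha)).add ha).sqrt) (Real.sqrt_pos.2 hDpos).ne'

/-- For general subspaces c need not converge, so only a difference can be controlled. By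
compactness of [0, 1] every subsequence has a further one along which c converges, and there
`tendsto_mapsCos` applies. -/
theorem tendsto_mapsCos_sub {t : ℝ} {x a g f c : ℕ → ℝ}
    (ht : 0 < t) (ht1 : t < 1) (hc : ∀ p, c p ∈ Set.Icc (0 : ℝ) 1)
    (hx : Tendsto x atTop (𝓝 t)) (ha : Tendsto (fun p => a p - t * c p) atTop (𝓝 0))
    (hg : Tendsto g atTop (𝓝 √t)) (hf : Tendsto (fun p => f p - √t * c p) atTop (𝓝 0)) :
    Tendsto (fun p => mapsCos (x p) (a p) (g p) (f p) - √(mapsCosSq t (c p))) atTop (𝓝 0) := by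
  refine tendsto_of_subseq_tendsto fun ns hns => ?_
  obtain ⟨d, hd, φ, hφ, hlim⟩ := isCompact_Icc.tendsto_subseq (fun p => hc (ns p))
  refine ⟨φ, ?_⟩
  have hs : Tendsto (fun p => ns (φ p)) atTop atTop := hns.comp hφ.tendsto_atTop
  have h1 := tendsto_mapsCos ht ht1 hd.1 hd.2 (hx.comp hs)
    (a := fun p => a (ns (φ p))) (by simpa using (ha.comp hs).add (hlim.const_mul t))
    (hg.comp hs) (f := fun p => f (ns (φ p)))
    (by simpa using (hf.comp hs).add (hlim.const_mul √t))
  have h2 := (tendsto_mapsCosSq ht ht1 hd.2 hlim).sqrt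
  simpa using h1.sub h2

/-! ### The eigenvector equation in terms of the n columns -/

/-- The `j`-th column of a matrix, as a vector of the Euclidean space. -/
def colVec {p n : ℕ} (R : Matrix (Fin p) (Fin n) ℝ) (j : Fin n) : EuclideanSpace ℝ (Fin p) :=
  WithLp.toLp 2 (fun i => R i j)

theorem inner_eq_sum {p : ℕ} (u v : EuclideanSpace ℝ (Fin p)) :
    inner ℝ u v = ∑ i, u i * v i := by
  simp [PiLp.inner_apply, mul_comm]

theorem norm_sq_eq_sum {p : ℕ} (u : EuclideanSpace ℝ (Fin p)) : ‖u‖ ^ 2 = ∑ i, u i ^ 2 := by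
  rw [EuclideanSpace.real_norm_sq_eq]

theorem sampleCov_toEuclideanLin {p n : ℕ} (R : Matrix (Fin p) (Fin n) ℝ)
    (v : EuclideanSpace ℝ (Fin p)) :
    (sampleCov R).toEuclideanLin v
      = (n : ℝ)⁻¹ • ∑ j, (inner ℝ v (colVec R j) : ℝ) • colVec R j := by
  ext i
  rw [Matrix.ofLp_toLpLin, Matrix.toLin'_apply, sampleCov, Matrix.smul_mulVec, ← Matrix.mulVec_mulVec]
  simp only [Pi.smul_apply, PiLp.smul_apply, smul_eq_mul, Matrix.mulVec, dotProduct, WithLp.ofLp_sum,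
    Finset.sum_apply, inner_eq_sum, colVec, Matrix.transpose_apply]
  congr 1
  refine Finset.sum_congr rfl fun j _ => ?_
  rw [mul_comm]
  congr 1
  exact Finset.sum_congr rfl fun k _ => mul_comm _ _

/-- Rayleigh bound: in an eigenbasis the quadratic form is a sum of eigenvalues weighted by squared
coordinates. -/
theorem inner_sampleCov_le {p n : ℕ} (R : Matrix (Fin p) (Fin n) ℝ)
    (v : EuclideanSpace ℝ (Fin p)) :
    inner ℝ ((sampleCov R).toEuclideanLin v) v ≤ sSq R * ‖v‖ ^ 2 := by
  set hA := sampleCov_isHermitian R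
  have hsym : (sampleCov R).toEuclideanLin.IsSymmetric :=
    Matrix.isSymmetric_toEuclideanLin_iff.2 hA
  have heig : ∀ i, (sampleCov R).toEuclideanLin (hA.eigenvectorBasis i)
      = hA.eigenvalues i • hA.eigenvectorBasis i := fun i => by
    ext k
    rw [Matrix.ofLp_toLpLin, Matrix.toLin'_apply, hA.mulVec_eigenvectorBasis]
    rfl
  rw [← hA.eigenvectorBasis.sum_inner_mul_inner, ← real_inner_self_eq_norm_sq,
    ← hA.eigenvectorBasis.sum_inner_mul_inner v v, Finset.mul_sum]
  refine Finset.sum_le_sum fun i _ => ?_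
  rw [hsym, heig, inner_smul_right, mul_assoc]
  refine mul_le_mul_of_nonneg_right (le_ciSup (Set.finite_range _).bddAbove i) ?_
  rw [real_inner_comm]
  exact mul_self_nonneg _

theorem sum_eigenvalues_sampleCov {p n : ℕ} (R : Matrix (Fin p) (Fin n) ℝ) :
    ∑ i, (sampleCov_isHermitian R).eigenvalues i = (n : ℝ)⁻¹ * ∑ j, ‖colVec R j‖ ^ 2 := by
  have h := (sampleCov_isHermitian R).trace_eq_sum_eigenvalues
  simp only [RCLike.ofReal_real_eq_id, id] at h
  rw [← h, sampleCov, Matrix.trace_smul, smul_eq_mul]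
  congr 1
  simp only [Matrix.trace, Matrix.diag, Matrix.mul_apply, Matrix.transpose_apply, norm_sq_eq_sum,
    colVec]
  rw [Finset.sum_comm]
  simp [sq]

/-- The scaled leading eigenvalue `n s² / p`. -/
noncomputable def scaledTop {p n : ℕ} (R : Matrix (Fin p) (Fin n) ℝ) : ℝ := n * sSq R / p

/-- The coordinates `⟨h, R_j⟩ / √p` of `Rᵀ h / √p`. -/
noncomputable def score {p n : ℕ} (R : Matrix (Fin p) (Fin n) ℝ) (h : EuclideanSpace ℝ (Fin p))
    (j : Fin n) : ℝ := inner ℝ h (colVec R j) / √p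

section

variable {p n : ℕ} {R : Matrix (Fin p) (Fin n) ℝ} {h : EuclideanSpace ℝ (Fin p)}

/-- This puts λh in the span of the n columns, with λ the scaled eigenvalue. It turns a problem in
the growing dimension p into one about the fixed number n of scores. -/
theorem scaledTop_smul (hn : n ≠ 0) (hh : IsPCA R h) :
    scaledTop R • h = ∑ j, (score R h j / √p) • colVec R j := by
  have h1 := hh.eigenvector
  rw [sampleCov_toEuclideanLin] at h1
  have h2 : scaledTop R • h = ((n : ℝ) / p) • (sSq R • h) := by
    rw [smul_smul, scaledTop]; congr 1; ring
  rw [h2, ← h1, smul_smul, Finset.smul_sum]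
  refine Finset.sum_congr rfl fun j _ => ?_
  rw [smul_smul, score, div_div, Real.mul_self_sqrt (Nat.cast_nonneg p)]
  congr 1
  have : (n : ℝ) ≠ 0 := by exact_mod_cast hn
  field_simp

theorem sum_score_sq (hn : n ≠ 0) (hh : IsPCA R h) :
    ∑ j, score R h j ^ 2 = scaledTop R := by
  have h1 : inner ℝ h (scaledTop R • h) = scaledTop R := by
    rw [inner_smul_right, real_inner_self_eq_norm_sq, hh.norm_eq_one]; simp
  rw [← h1, scaledTop_smul hn hh, inner_sum]
  refine Finset.sum_congr rfl fun j _ => ?_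
  rw [inner_smul_right, score]; ring

theorem sum_inner_sq_le (hn : n ≠ 0) (v : EuclideanSpace ℝ (Fin p)) :
    ∑ j, (inner ℝ v (colVec R j)) ^ 2 / p ≤ scaledTop R * ‖v‖ ^ 2 := by
  have h1 := inner_sampleCov_le R v
  rw [sampleCov_toEuclideanLin, inner_smul_left, sum_inner] at h1
  simp only [inner_smul_left, RCLike.conj_to_real, map_inv₀, map_natCast] at h1
  have h2 : ∑ j, (inner ℝ v (colVec R j)) ^ 2 / p = (n : ℝ) / p * ((n : ℝ)⁻¹ *
      ∑ j, inner ℝ v (colVec R j) * inner ℝ (colVec R j) v) := by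
    rw [← mul_assoc, Finset.mul_sum]
    refine Finset.sum_congr rfl fun j _ => ?_
    have : (n : ℝ) ≠ 0 := by exact_mod_cast hn
    rw [real_inner_comm v (colVec R j)]
    field_simp
  rw [h2]
  calc _ ≤ (n : ℝ) / p * (sSq R * ‖v‖ ^ 2) := by gcongr
    _ = _ := by rw [scaledTop]; ring

theorem scaledTop_nonneg (hn : n ≠ 0) (hh : IsPCA R h) : 0 ≤ scaledTop R := by
  rw [← sum_score_sq hn hh]; positivity

theorem psi_eq (hp : p ≠ 0) (hn : 2 ≤ n) :
    psi R = √((scaledTop R - ((∑ j, ‖colVec R j‖ ^ 2 / p) - scaledTop R) / ((n : ℝ) - 1))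
      / scaledTop R) := by
  have h1 : (n : ℝ) - 1 ≠ 0 := by
    have : (2 : ℝ) ≤ n := by exact_mod_cast hn
    linarith
  have h2 : (n : ℝ) ≠ 0 := by
    have : (2 : ℝ) ≤ n := by exact_mod_cast hn
    linarith
  have h3 : (p : ℝ) ≠ 0 := by exact_mod_cast hp
  have h4 : scaledTop R - ((∑ j, ‖colVec R j‖ ^ 2 / p) - scaledTop R) / ((n : ℝ) - 1)
      = (n / p) * (sSq R - lSq R) := by
    rw [lSq, sum_eigenvalues_sampleCov, scaledTop, ← Finset.sum_div]
    field_simp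
  have h5 : scaledTop R = (n / p) * sSq R := by rw [scaledTop]; ring
  rw [psi, h4, h5, mul_div_mul_left _ _ (by positivity)]

end

/-! ### Limits of the Gram matrix and of the leading eigenvalue -/

/-- The `j`-th column of the noise array, truncated to the first `p` rows. -/
def noiseVec {n : ℕ} (Z : ℕ → Fin n → ℝ) (j : Fin n) (p : ℕ) : EuclideanSpace ℝ (Fin p) :=
  WithLp.toLp 2 (fun i => Z i j)

theorem colVec_returns {n : ℕ} (β : ℕ → ℝ) (X : Fin n → ℝ) (Z : ℕ → Fin n → ℝ) (p : ℕ)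
    (j : Fin n) : colVec (returns β X Z p) j = X j • betaVec β p + noiseVec Z j p := by
  ext i
  simp [colVec, returns, betaVec, noiseVec, mul_comm]

/-- The limits which the laws of large numbers yield for almost every realisation of `β` and
`Z`. -/
structure LimitLaws {n : ℕ} (β : ℕ → ℝ) (Z : ℕ → Fin n → ℝ) (δ B μ : ℝ) : Prop where
  B_pos : 0 < B
  mean_pos : 0 < μ
  beta_sq : Tendsto (fun p => ‖betaVec β p‖ ^ 2 / p) atTop (𝓝 B)
  beta_q : Tendsto (fun p => inner ℝ (betaVec β p) (qVec p) / √p) atTop (𝓝 μ)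
  noise : ∀ j k, Tendsto (fun p => inner ℝ (noiseVec Z j p) (noiseVec Z k p) / (p : ℝ)) atTop
    (𝓝 (if j = k then δ ^ 2 else 0))
  beta_noise : ∀ j, Tendsto (fun p => inner ℝ (betaVec β p) (noiseVec Z j p) / (p : ℝ)) atTop (𝓝 0)
  noise_q : ∀ j, Tendsto (fun p => inner ℝ (noiseVec Z j p) (qVec p) / √p) atTop (𝓝 0)

section

variable {n : ℕ} {β : ℕ → ℝ} {X : Fin n → ℝ} {Z : ℕ → Fin n → ℝ} {δ B μ : ℝ}

theorem LimitLaws.tendsto_gram (hl : LimitLaws β Z δ B μ) (X : Fin n → ℝ) (j k : Fin n) :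
    Tendsto (fun p => inner ℝ (colVec (returns β X Z p) j) (colVec (returns β X Z p) k) / (p : ℝ))
      atTop (𝓝 (B * (X j * X k) + if j = k then δ ^ 2 else 0)) := by
  have h1 := (((hl.beta_sq.mul_const (X j * X k)).add ((hl.beta_noise k).const_mul (X j))).add
    ((hl.beta_noise j).const_mul (X k))).add (hl.noise j k)
  simp only [mul_zero, add_zero] at h1
  refine h1.congr fun p => ?_
  rw [colVec_returns, colVec_returns]
  simp only [inner_add_left, inner_add_right, inner_smul_left, inner_smul_right,
    real_inner_self_eq_norm_sq, RCLike.conj_to_real, real_inner_comm (betaVec β p) (noiseVec Z j p)]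
  ring

theorem sum_sq_pos_of_ne_zero (hX : X ≠ 0) : 0 < ∑ j, X j ^ 2 := by
  obtain ⟨j, hj⟩ := Function.ne_iff.1 hX
  exact Finset.sum_pos' (fun _ _ => sq_nonneg _) ⟨j, Finset.mem_univ _, sq_pos_iff.2 hj⟩

/-- The limit of the scaled leading eigenvalue. -/
def topLimit (X : Fin n → ℝ) (δ B : ℝ) : ℝ := B * ∑ j, X j ^ 2 + δ ^ 2

variable {h : (p : ℕ) → EuclideanSpace ℝ (Fin p)}

/-- The sum of the entries of the deviation of the scaled Gram matrix from its limit. -/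
noncomputable def gramError (β : ℕ → ℝ) (X : Fin n → ℝ) (Z : ℕ → Fin n → ℝ) (δ B : ℝ) (p : ℕ) : ℝ :=
  ∑ j, ∑ k, |inner ℝ (colVec (returns β X Z p) j) (colVec (returns β X Z p) k) / (p : ℝ)
    - (B * (X j * X k) + if j = k then δ ^ 2 else 0)|

theorem LimitLaws.tendsto_gramError (hl : LimitLaws β Z δ B μ) (X : Fin n → ℝ) :
    Tendsto (gramError β X Z δ B) atTop (𝓝 0) := by
  have : Tendsto (gramError β X Z δ B) atTop (𝓝 (∑ _j : Fin n, ∑ _k : Fin n, |(0 : ℝ)|)) := by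
    refine tendsto_finsetSum _ fun j _ => tendsto_finsetSum _ fun k _ => ?_
    have := (hl.tendsto_gram X j k).sub_const (B * (X j * X k) + if j = k then δ ^ 2 else 0)
    rw [sub_self] at this
    exact this.abs
  simpa using this

/-- With λ the scaled eigenvalue, G = RᵀR/p and y the score vector, |y|² = λ and yᵀGy = ‖λh‖² = λ².
Replacing G by its limit turns yᵀGy into B⟨X, y⟩² + δ²λ, and every entry of the error is weighted by
|y_j y_k| ≤ λ. -/
theorem abs_scaledTop_sq_sub_le (hn : n ≠ 0) {p : ℕ} {v : EuclideanSpace ℝ (Fin p)}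
    (hv : IsPCA (returns β X Z p) v) :
    |scaledTop (returns β X Z p) ^ 2 - B * (∑ j, X j * score (returns β X Z p) v j) ^ 2
      - δ ^ 2 * scaledTop (returns β X Z p)|
      ≤ gramError β X Z δ B p * scaledTop (returns β X Z p) := by
  set R := returns β X Z p
  set y := score R v
  have hy : ∀ j, |y j| ≤ √(scaledTop R) := fun j => by
    apply Real.abs_le_sqrt
    rw [← sum_score_sq hn hv]
    exact Finset.single_le_sum (fun i _ => sq_nonneg (y i)) (Finset.mem_univ j)
  have h1 : scaledTop R ^ 2 = ∑ j, ∑ k, y j * y k * (inner ℝ (colVec R j) (colVec R k) / p) := by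
    have h2 : ‖scaledTop R • v‖ ^ 2 = scaledTop R ^ 2 := by
      rw [norm_smul, hv.norm_eq_one, mul_one, Real.norm_eq_abs, sq_abs]
    rw [← h2, scaledTop_smul hn hv, ← real_inner_self_eq_norm_sq, sum_inner]
    refine Finset.sum_congr rfl fun j _ => ?_
    rw [inner_sum]
    refine Finset.sum_congr rfl fun k _ => ?_
    rw [inner_smul_left, inner_smul_right, RCLike.conj_to_real]
    have hp : (p : ℝ)⁻¹ = (√p)⁻¹ * (√p)⁻¹ := by
      rw [← mul_inv, Real.mul_self_sqrt (Nat.cast_nonneg p)]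
    simp only [div_eq_mul_inv, hp, y]
    ring
  have h3 : B * (∑ j, X j * y j) ^ 2 + δ ^ 2 * scaledTop R
      = ∑ j, ∑ k, y j * y k * (B * (X j * X k) + if j = k then δ ^ 2 else 0) := by
    simp only [mul_add, Finset.sum_add_distrib, mul_ite, mul_zero, Finset.sum_ite_eq,
      Finset.mem_univ, if_true]
    congr 1
    · rw [sq, Finset.sum_mul_sum, Finset.mul_sum]
      refine Finset.sum_congr rfl fun j _ => ?_
      rw [Finset.mul_sum]
      exact Finset.sum_congr rfl fun k _ => by ring
    · rw [← sum_score_sq hn hv, Finset.mul_sum]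
      exact Finset.sum_congr rfl fun k _ => by ring
  rw [sub_sub, h3, h1, ← Finset.sum_sub_distrib, gramError, Finset.sum_mul]
  refine (Finset.abs_sum_le_sum_abs _ _).trans (Finset.sum_le_sum fun j _ => ?_)
  rw [← Finset.sum_sub_distrib, Finset.sum_mul]
  refine (Finset.abs_sum_le_sum_abs _ _).trans (Finset.sum_le_sum fun k _ => ?_)
  rw [← mul_sub, abs_mul, mul_comm]
  gcongr
  rw [abs_mul, ← Real.mul_self_sqrt (scaledTop_nonneg hn hv)]
  exact mul_le_mul (hy j) (hy k) (abs_nonneg _) (Real.sqrt_nonneg _)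

theorem sum_mul_score_sq_le (hn : n ≠ 0) {p : ℕ} {v : EuclideanSpace ℝ (Fin p)}
    (hv : IsPCA (returns β X Z p) v) :
    (∑ j, X j * score (returns β X Z p) v j) ^ 2
      ≤ (∑ j, X j ^ 2) * scaledTop (returns β X Z p) := by
  rw [← sum_score_sq hn hv]
  exact Finset.sum_mul_sq_le_sq_mul_sq _ _ _

theorem scaledTop_le (hn : n ≠ 0) (hB : 0 ≤ B) {p : ℕ} {v : EuclideanSpace ℝ (Fin p)}
    (hv : IsPCA (returns β X Z p) v) :
    scaledTop (returns β X Z p) ≤ topLimit X δ B + gramError β X Z δ B p := by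
  have h1 := (abs_le.1 (abs_scaledTop_sq_sub_le (δ := δ) (B := B) hn hv)).2
  have h2 := mul_le_mul_of_nonneg_left (sum_mul_score_sq_le hn hv) hB
  have h3 := scaledTop_nonneg hn hv
  have h4 : 0 ≤ gramError β X Z δ B p :=
    Finset.sum_nonneg fun _ _ => Finset.sum_nonneg fun _ _ => abs_nonneg _
  have h5 : 0 ≤ ∑ j, X j ^ 2 := Finset.sum_nonneg fun _ _ => sq_nonneg _
  unfold topLimit
  -- For λ > 0, Cauchy–Schwarz bounds λ² by (topLimit + error) λ, and one factor λ cancels.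
  rcases h3.eq_or_lt with h0 | h0
  · rw [← h0]; positivity
  · refine le_of_mul_le_mul_right (a := scaledTop (returns β X Z p)) ?_ h0
    nlinarith

theorem LimitLaws.topLimit_pos (hl : LimitLaws β Z δ B μ) (hX : X ≠ 0) : 0 < topLimit X δ B := by
  have := mul_pos hl.B_pos (sum_sq_pos_of_ne_zero hX)
  unfold topLimit; positivity

/-- The upper bound is `scaledTop_le`. The lower bound is the Rayleigh quotient at RX/√p, which
equals |GX|²/⟨X, GX⟩ for G = RᵀR/p; X is an eigenvector of the limit of G for the eigenvalue
`topLimit`, so the quotient tends to that value. -/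
theorem LimitLaws.tendsto_scaledTop (hl : LimitLaws β Z δ B μ) (hn : n ≠ 0) (hX : X ≠ 0)
    (hh : ∀ p, 1 ≤ p → IsPCA (returns β X Z p) (h p)) :
    Tendsto (fun p => scaledTop (returns β X Z p)) atTop (𝓝 (topLimit X δ B)) := by
  have hx := sum_sq_pos_of_ne_zero hX
  have hΛ := hl.topLimit_pos hX
  set M : ℕ → Fin n → Fin n → ℝ := fun p j k =>
    inner ℝ (colVec (returns β X Z p) j) (colVec (returns β X Z p) k) / (p : ℝ)
  have hu : ∀ k, Tendsto (fun p => ∑ j, X j * M p j k) atTop (𝓝 (topLimit X δ B * X k)) := by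
    intro k
    have h1 := tendsto_finsetSum (Finset.univ : Finset (Fin n))
      fun j _ => (hl.tendsto_gram X j k).const_mul (X j)
    convert h1 using 2
    simp only [mul_add, mul_ite, mul_zero, Finset.sum_add_distrib, Finset.sum_ite_eq',
      Finset.mem_univ, if_true, topLimit, add_mul, Finset.mul_sum, Finset.sum_mul]
    congr 1
    · exact Finset.sum_congr rfl fun _ _ => by ring
    · ring
  have hnum := tendsto_finsetSum (Finset.univ : Finset (Fin n)) fun k _ => (hu k).pow 2
  have hden := tendsto_finsetSum (Finset.univ : Finset (Fin n)) fun k _ => (hu k).const_mul (X k)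
  have hlim1 : ∑ k, (topLimit X δ B * X k) ^ 2 = topLimit X δ B ^ 2 * ∑ k, X k ^ 2 := by
    rw [Finset.mul_sum]; exact Finset.sum_congr rfl fun _ _ => by ring
  have hlim2 : ∑ k, X k * (topLimit X δ B * X k) = topLimit X δ B * ∑ k, X k ^ 2 := by
    rw [Finset.mul_sum]; exact Finset.sum_congr rfl fun _ _ => by ring
  rw [hlim1] at hnum
  rw [hlim2] at hden
  have hquot := hnum.div hden (by positivity)
  have h9 : topLimit X δ B ^ 2 * ∑ k, X k ^ 2 = topLimit X δ B * (topLimit X δ B * ∑ k, X k ^ 2) := by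
    ring
  rw [h9, mul_div_cancel_right₀ _ (by positivity)] at hquot
  have hup : Tendsto (fun p => topLimit X δ B + gramError β X Z δ B p) atTop
      (𝓝 (topLimit X δ B)) := by simpa using (hl.tendsto_gramError X).const_add (topLimit X δ B)
  refine tendsto_of_tendsto_of_tendsto_of_le_of_le' hquot hup ?_ ?_
  · filter_upwards [eventually_ge_atTop 1, hden.eventually (lt_mem_nhds (by positivity))]
      with p hp hpos
    have hp0 : (0 : ℝ) < p := by exact_mod_cast hp
    rw [Pi.div_apply, div_le_iff₀ hpos]
    have h1 := sum_inner_sq_le (R := returns β X Z p) hn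
      ((√p)⁻¹ • ∑ j, X j • colVec (returns β X Z p) j)
    have h2 : ‖(√p)⁻¹ • ∑ j, X j • colVec (returns β X Z p) j‖ ^ 2
        = ∑ k, X k * ∑ j, X j * M p j k := by
      rw [← real_inner_self_eq_norm_sq, inner_smul_left, inner_smul_right, inner_sum,
        RCLike.conj_to_real, ← mul_assoc, ← mul_inv, Real.mul_self_sqrt hp0.le, Finset.mul_sum]
      refine Finset.sum_congr rfl fun k _ => ?_
      rw [inner_smul_right, sum_inner, Finset.mul_sum, Finset.mul_sum, Finset.mul_sum]
      refine Finset.sum_congr rfl fun j _ => ?_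
      rw [inner_smul_left, RCLike.conj_to_real]
      simp only [M]; ring
    have h3 : ∑ k, (inner ℝ ((√p)⁻¹ • ∑ j, X j • colVec (returns β X Z p) j)
        (colVec (returns β X Z p) k)) ^ 2 / p = ∑ k, (∑ j, X j * M p j k) ^ 2 := by
      refine Finset.sum_congr rfl fun k _ => ?_
      have h4 : ∑ j, X j * M p j k = (p : ℝ)⁻¹ * inner ℝ (∑ j, X j • colVec (returns β X Z p) j)
          (colVec (returns β X Z p) k) := by
        rw [sum_inner, Finset.mul_sum]
        refine Finset.sum_congr rfl fun j _ => ?_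
        rw [inner_smul_left, RCLike.conj_to_real]
        simp only [M]; ring
      rw [h4, inner_smul_left, RCLike.conj_to_real, mul_pow, mul_pow, inv_pow, Real.sq_sqrt hp0.le]
      field_simp
    rw [h2, h3] at h1
    exact h1
  · filter_upwards [eventually_ge_atTop 1] with p hp
    exact scaledTop_le hn hl.B_pos.le (hh p hp)

end

/-! ### Asymptotics of the PCA estimator and of ψ -/

theorem sqrt_le_sqrt_add_sqrt_abs_sub (x y : ℝ) : √x ≤ √y + √|x - y| := by
  rcases le_total y 0 with hy | hy
  · rw [Real.sqrt_eq_zero_of_nonpos hy, zero_add]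
    exact Real.sqrt_le_sqrt (by linarith [le_abs_self (x - y)])
  · rw [Real.sqrt_le_left (by positivity), add_sq, Real.sq_sqrt hy, Real.sq_sqrt (abs_nonneg _)]
    nlinarith [le_abs_self (x - y), mul_nonneg (Real.sqrt_nonneg y) (Real.sqrt_nonneg |x - y|)]

/-- Hölder continuity of the square root, valid for negative arguments too, where `√` is 0. It
passes from cosines to distances √(2 - 2 cos) without keeping the distances away from 0. -/
theorem abs_sqrt_sub_sqrt_le (x y : ℝ) : |√x - √y| ≤ √|x - y| := by
  rw [abs_sub_le_iff]
  constructor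
  · linarith [sqrt_le_sqrt_add_sqrt_abs_sub x y]
  · rw [abs_sub_comm]
    linarith [sqrt_le_sqrt_add_sqrt_abs_sub y x]

/-- The limit of `ψ²`. -/
noncomputable def psiSqLimit {n : ℕ} (X : Fin n → ℝ) (δ B : ℝ) : ℝ :=
  B * (∑ j, X j ^ 2) / topLimit X δ B

section

variable {n : ℕ} {β : ℕ → ℝ} {X : Fin n → ℝ} {Z : ℕ → Fin n → ℝ} {δ B μ : ℝ}
  {h : (p : ℕ) → EuclideanSpace ℝ (Fin p)}

theorem LimitLaws.psiSqLimit_pos (hl : LimitLaws β Z δ B μ) (hX : X ≠ 0) :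
    0 < psiSqLimit X δ B :=
  div_pos (mul_pos hl.B_pos (sum_sq_pos_of_ne_zero hX)) (hl.topLimit_pos hX)

theorem LimitLaws.psiSqLimit_lt_one (hl : LimitLaws β Z δ B μ) (hX : X ≠ 0) (hδ : 0 < δ) :
    psiSqLimit X δ B < 1 := by
  rw [psiSqLimit, div_lt_one (hl.topLimit_pos hX), topLimit]
  have : 0 < δ ^ 2 := by positivity
  linarith

/-- The noise part of `(n s² / p) h`. -/
noncomputable def noisePart {n p : ℕ} (β : ℕ → ℝ) (X : Fin n → ℝ) (Z : ℕ → Fin n → ℝ)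
    (v : EuclideanSpace ℝ (Fin p)) : EuclideanSpace ℝ (Fin p) :=
  ∑ j, (score (returns β X Z p) v j / √p) • noiseVec Z j p

theorem scaledTop_smul_eq (hn : n ≠ 0) {p : ℕ} {v : EuclideanSpace ℝ (Fin p)}
    (hv : IsPCA (returns β X Z p) v) :
    scaledTop (returns β X Z p) • v
      = ((∑ j, X j * score (returns β X Z p) v j) / √p) • betaVec β p + noisePart β X Z v := by
  rw [scaledTop_smul hn hv, noisePart, Finset.sum_div, Finset.sum_smul, ← Finset.sum_add_distrib]
  refine Finset.sum_congr rfl fun j _ => ?_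
  rw [colVec_returns, smul_add, smul_smul]
  congr 2
  ring

theorem abs_score_le (hn : n ≠ 0) {p : ℕ} {v : EuclideanSpace ℝ (Fin p)}
    {R : Matrix (Fin p) (Fin n) ℝ} (hv : IsPCA R v) (j : Fin n) :
    |score R v j| ≤ √(scaledTop R) := by
  apply Real.abs_le_sqrt
  rw [← sum_score_sq hn hv]
  exact Finset.single_le_sum (f := fun j => score R v j ^ 2) (fun i _ => sq_nonneg _)
    (Finset.mem_univ j)

/-- The image of the noise part under a sequence of linear maps tends to zero if the images of
the scaled columns of the noise do. -/
theorem LimitLaws.tendsto_map_noisePart {F : ℕ → Type*} [∀ p, NormedAddCommGroup (F p)]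
    [∀ p, NormedSpace ℝ (F p)]
    (hl : LimitLaws β Z δ B μ) (hn : n ≠ 0) (hX : X ≠ 0)
    (hh : ∀ p, 1 ≤ p → IsPCA (returns β X Z p) (h p))
    (T : (p : ℕ) → EuclideanSpace ℝ (Fin p) →L[ℝ] F p)
    (hT : ∀ j, Tendsto (fun p => ‖T p (noiseVec Z j p)‖ / √p) atTop (𝓝 0)) :
    Tendsto (fun p => ‖T p (noisePart β X Z (h p))‖) atTop (𝓝 0) := by
  have h1 := tendsto_finsetSum (Finset.univ : Finset (Fin n))
    fun j _ => ((hl.tendsto_scaledTop hn hX hh).sqrt).mul (hT j)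
  simp only [mul_zero, Finset.sum_const_zero] at h1
  refine squeeze_zero' (Eventually.of_forall fun p => norm_nonneg _) ?_ h1
  filter_upwards [eventually_ge_atTop 1] with p hp
  rw [noisePart, map_sum]
  refine (norm_sum_le _ _).trans (Finset.sum_le_sum fun j _ => ?_)
  rw [map_smul, norm_smul, norm_div, Real.norm_eq_abs, Real.norm_eq_abs,
    abs_of_nonneg (Real.sqrt_nonneg _), div_mul_eq_mul_div, mul_div_assoc]
  exact mul_le_mul_of_nonneg_right (abs_score_le hn (hh p hp) j) (by positivity)

theorem LimitLaws.tendsto_inner_noisePart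
    (hl : LimitLaws β Z δ B μ) (hn : n ≠ 0) (hX : X ≠ 0)
    (hh : ∀ p, 1 ≤ p → IsPCA (returns β X Z p) (h p))
    (u : (p : ℕ) → EuclideanSpace ℝ (Fin p))
    (hu : ∀ j, Tendsto (fun p => inner ℝ (noiseVec Z j p) (u p) / √p) atTop (𝓝 0)) :
    Tendsto (fun p => inner ℝ (u p) (noisePart β X Z (h p))) atTop (𝓝 0) := by
  have := hl.tendsto_map_noisePart hn hX hh (fun p => innerSL ℝ (u p)) (fun j => by
    have h1 := (hu j).norm
    rw [norm_zero] at h1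
    refine h1.congr fun p => ?_
    rw [norm_div, innerSL_apply_apply, real_inner_comm, Real.norm_eq_abs √_,
      abs_of_nonneg (Real.sqrt_nonneg _)])
  exact tendsto_zero_iff_norm_tendsto_zero.2 this

/-- The Gram identity determines the limit of the square of s = ⟨X, y⟩, y being the score vector;
the sign convention on h determines the sign. -/
theorem LimitLaws.tendsto_sum_mul_score (hl : LimitLaws β Z δ B μ) (hn : n ≠ 0) (hX : X ≠ 0)
    (hh : ∀ p, 1 ≤ p → IsPCA (returns β X Z p) (h p)) :
    Tendsto (fun p => ∑ j, X j * score (returns β X Z p) (h p) j) atTop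
      (𝓝 √(topLimit X δ B * ∑ j, X j ^ 2)) := by
  set s : ℕ → ℝ := fun p => ∑ j, X j * score (returns β X Z p) (h p) j
  set Λ := topLimit X δ B
  have hlam := hl.tendsto_scaledTop hn hX hh
  have hsq : Tendsto (fun p => s p ^ 2) atTop (𝓝 (Λ * ∑ j, X j ^ 2)) := by
    have h1 : Tendsto (fun p => scaledTop (returns β X Z p) ^ 2 - B * s p ^ 2
        - δ ^ 2 * scaledTop (returns β X Z p)) atTop (𝓝 0) := by
      have h2 := (hl.tendsto_gramError X).mul hlam
      rw [zero_mul] at h2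
      refine squeeze_zero_norm' ?_ h2
      filter_upwards [eventually_ge_atTop 1] with p hp
      exact abs_scaledTop_sq_sub_le hn (hh p hp)
    have h3 := (((hlam.pow 2).sub (hlam.const_mul (δ ^ 2))).sub h1).div_const B
    have h4 : (Λ ^ 2 - δ ^ 2 * Λ - 0) / B = Λ * ∑ j, X j ^ 2 := by
      have := hl.B_pos.ne'
      rw [div_eq_iff this]
      simp only [Λ, topLimit]; ring
    rw [h4] at h3
    refine h3.congr fun p => ?_
    have := hl.B_pos.ne'
    field_simp
    ring
  have habs : Tendsto (fun p => |s p|) atTop (𝓝 √(Λ * ∑ j, X j ^ 2)) :=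
    hsq.sqrt.congr fun p => Real.sqrt_sq_eq_abs _
  have hq := hl.tendsto_inner_noisePart hn hX hh qVec hl.noise_q
  -- Pairing the decomposition of λh with q gives 0 ≤ λ⟨h, q⟩ = s ⟨β, q⟩/√p + o(1). Since ⟨β, q⟩/√p
  -- tends to μ > 0, the negative part of s vanishes in the limit, and s = |s| - 2 max(-s, 0).
  have hneg : Tendsto (fun p => max (-s p) 0) atTop (𝓝 0) := by
    have h1 := hq.abs.div hl.beta_q hl.mean_pos.ne'
    simp only [abs_zero, zero_div] at h1
    refine squeeze_zero' (Eventually.of_forall fun p => le_max_right _ _) ?_ h1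
    filter_upwards [eventually_ge_atTop 1, hl.beta_q.eventually (lt_mem_nhds hl.mean_pos)]
      with p hp hpos
    refine max_le ?_ (div_nonneg (abs_nonneg _) hpos.le)
    rw [Pi.div_apply, le_div_iff₀ hpos]
    have h2 : 0 ≤ scaledTop (returns β X Z p) * inner ℝ (h p) (qVec p) :=
      mul_nonneg (scaledTop_nonneg hn (hh p hp)) (hh p hp).inner_nonneg
    have h3 : scaledTop (returns β X Z p) * inner ℝ (h p) (qVec p)
        = s p * (inner ℝ (betaVec β p) (qVec p) / √p)
          + inner ℝ (qVec p) (noisePart β X Z (h p)) := by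
      have h4 := scaledTop_smul_eq hn (hh p hp)
      have h5 := congrArg (fun w => inner ℝ w (qVec p)) h4
      simp only [inner_add_left, inner_smul_left, RCLike.conj_to_real] at h5
      rw [h5, real_inner_comm (qVec p) (noisePart β X Z (h p))]
      ring
    have h6 := le_abs_self (inner ℝ (qVec p) (noisePart β X Z (h p)))
    rw [h3] at h2
    linarith
  have h7 := habs.sub (hneg.const_mul 2)
  rw [mul_zero, sub_zero] at h7
  refine h7.congr fun p => ?_
  rcases le_total 0 (s p) with h0 | h0
  · rw [abs_of_nonneg h0, max_eq_right (by linarith)]; ring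
  · rw [abs_of_nonpos h0, max_eq_left (by linarith)]; ring

theorem LimitLaws.tendsto_norm_beta (hl : LimitLaws β Z δ B μ) :
    Tendsto (fun p => ‖betaVec β p‖ / √p) atTop (𝓝 √B) := by
  refine hl.beta_sq.sqrt.congr fun p => ?_
  rw [Real.sqrt_div (sq_nonneg _), Real.sqrt_sq (norm_nonneg _)]

theorem LimitLaws.eventually_betaVec_ne_zero (hl : LimitLaws β Z δ B μ) :
    ∀ᶠ p in atTop, betaVec β p ≠ 0 := by
  filter_upwards [hl.beta_sq.eventually (lt_mem_nhds hl.B_pos)] with p hp h0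
  simp [h0] at hp

theorem norm_bVec {p : ℕ} (h0 : betaVec β p ≠ 0) : ‖bVec β p‖ = 1 := by
  rw [bVec, norm_smul, norm_inv, norm_norm, inv_mul_cancel₀ (norm_ne_zero_iff.2 h0)]

theorem norm_bVec_le (β : ℕ → ℝ) (p : ℕ) : ‖bVec β p‖ ≤ 1 := by
  by_cases h0 : betaVec β p = 0
  · simp [bVec, h0]
  · exact (norm_bVec h0).le

theorem norm_smul_bVec (β : ℕ → ℝ) (p : ℕ) : ‖betaVec β p‖ • bVec β p = betaVec β p := by
  by_cases h0 : betaVec β p = 0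
  · simp [bVec, h0]
  · rw [bVec, smul_smul, mul_inv_cancel₀ (norm_ne_zero_iff.2 h0), one_smul]

/-- The coefficient of `b` in the decomposition of `h` into signal and noise. -/
theorem LimitLaws.tendsto_coefficient (hl : LimitLaws β Z δ B μ) (hn : n ≠ 0) (hX : X ≠ 0)
    (hh : ∀ p, 1 ≤ p → IsPCA (returns β X Z p) (h p)) :
    Tendsto (fun p => (scaledTop (returns β X Z p))⁻¹ *
      ((∑ j, X j * score (returns β X Z p) (h p) j) * (‖betaVec β p‖ / √p))) atTop
      (𝓝 √(psiSqLimit X δ B)) := by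
  have hΛ := hl.topLimit_pos hX
  have h1 := ((hl.tendsto_scaledTop hn hX hh).inv₀ hΛ.ne').mul
    ((hl.tendsto_sum_mul_score hn hX hh).mul hl.tendsto_norm_beta)
  convert h1 using 2
  have hx := sum_sq_pos_of_ne_zero hX
  rw [← Real.sqrt_mul (by positivity), eq_inv_mul_iff_mul_eq₀ hΛ.ne', psiSqLimit]
  nth_rewrite 1 [← Real.sqrt_sq hΛ.le]
  rw [← Real.sqrt_mul (by positivity)]
  congr 1
  field_simp

/-- In h = a b + λ⁻¹ noise the coefficient a tends to √t. The general contraction T serves both for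
orthogonal projections and for the functional ⟨b, ·⟩. -/
theorem LimitLaws.tendsto_map_sub {F : ℕ → Type*} [∀ p, NormedAddCommGroup (F p)]
    [∀ p, NormedSpace ℝ (F p)]
    (hl : LimitLaws β Z δ B μ) (hn : n ≠ 0) (hX : X ≠ 0)
    (hh : ∀ p, 1 ≤ p → IsPCA (returns β X Z p) (h p))
    (T : (p : ℕ) → EuclideanSpace ℝ (Fin p) →L[ℝ] F p) (hT1 : ∀ p, ‖T p‖ ≤ 1)
    (hT : ∀ j, Tendsto (fun p => ‖T p (noiseVec Z j p)‖ / √p) atTop (𝓝 0)) :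
    Tendsto (fun p => ‖T p (h p) - √(psiSqLimit X δ B) • T p (bVec β p)‖) atTop (𝓝 0) := by
  have hΛ := hl.topLimit_pos hX
  have hlam := hl.tendsto_scaledTop hn hX hh
  have h1 := ((hl.tendsto_coefficient hn hX hh).sub_const √(psiSqLimit X δ B)).abs.add
    ((hlam.inv₀ hΛ.ne').abs.mul (hl.tendsto_map_noisePart hn hX hh T hT))
  simp only [sub_self, abs_zero, mul_zero, add_zero] at h1
  refine squeeze_zero' (Eventually.of_forall fun p => norm_nonneg _) ?_ h1
  filter_upwards [eventually_ge_atTop 1, hlam.eventually (lt_mem_nhds hΛ)] with p hp hpos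
  set a := (scaledTop (returns β X Z p))⁻¹ *
      ((∑ j, X j * score (returns β X Z p) (h p) j) * (‖betaVec β p‖ / √p))
  have h2 : h p = a • bVec β p + (scaledTop (returns β X Z p))⁻¹ • noisePart β X Z (h p) := by
    have h3 := congrArg (fun w => (scaledTop (returns β X Z p))⁻¹ • w)
      (scaledTop_smul_eq hn (hh p hp))
    simp only [smul_smul, inv_mul_cancel₀ hpos.ne', one_smul, smul_add] at h3
    refine h3.trans ?_
    congr 1
    conv_lhs => rw [← norm_smul_bVec, smul_smul]
    congr 1
    simp only [a]; ring
  have h4 : T p (h p) - √(psiSqLimit X δ B) • T p (bVec β p)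
      = (a - √(psiSqLimit X δ B)) • T p (bVec β p)
        + (scaledTop (returns β X Z p))⁻¹ • T p (noisePart β X Z (h p)) := by
    conv_lhs => rw [h2]
    rw [map_add, map_smul, map_smul, sub_smul]
    abel
  rw [h4]
  refine (norm_add_le _ _).trans ?_
  rw [norm_smul, norm_smul, Real.norm_eq_abs, Real.norm_eq_abs]
  gcongr
  refine mul_le_of_le_one_right (abs_nonneg _) (((T p).le_opNorm _).trans ?_)
  exact mul_le_one₀ (hT1 p) (norm_nonneg _) (norm_bVec_le β p)

theorem LimitLaws.tendsto_inner_noise_bVec (hl : LimitLaws β Z δ B μ) (j : Fin n) :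
    Tendsto (fun p => inner ℝ (noiseVec Z j p) (bVec β p) / √p) atTop (𝓝 0) := by
  have h1 := (hl.beta_noise j).div hl.tendsto_norm_beta (Real.sqrt_pos.2 hl.B_pos).ne'
  rw [zero_div] at h1
  refine h1.congr' ?_
  filter_upwards [eventually_ge_atTop 1, hl.eventually_betaVec_ne_zero] with p hp h0
  have hp0 : 0 < √(p : ℝ) := Real.sqrt_pos.2 (by exact_mod_cast hp)
  have h2 := norm_ne_zero_iff.2 h0
  have h3 : (p : ℝ) = √p * √p := (Real.mul_self_sqrt (Nat.cast_nonneg p)).symm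
  rw [Pi.div_apply, bVec, inner_smul_right, real_inner_comm (noiseVec Z j p)]
  conv_lhs => rw [h3]
  rw [Real.sqrt_mul_self hp0.le]
  field_simp

theorem LimitLaws.tendsto_inner_bVec (hl : LimitLaws β Z δ B μ) (hn : n ≠ 0) (hX : X ≠ 0)
    (hh : ∀ p, 1 ≤ p → IsPCA (returns β X Z p) (h p)) :
    Tendsto (fun p => inner ℝ (h p) (bVec β p)) atTop (𝓝 √(psiSqLimit X δ B)) := by
  have h1 := hl.tendsto_map_sub hn hX hh (fun p => innerSL ℝ (bVec β p))
    (fun p => by rw [innerSL_apply_norm]; exact norm_bVec_le β p) (fun j => by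
      have h1 := (hl.tendsto_inner_noise_bVec j).norm
      rw [norm_zero] at h1
      refine h1.congr fun p => ?_
      rw [norm_div, innerSL_apply_apply, real_inner_comm, Real.norm_eq_abs √_,
        abs_of_nonneg (Real.sqrt_nonneg _)])
  have h2 := (tendsto_zero_iff_norm_tendsto_zero.2 h1).add_const √(psiSqLimit X δ B)
  rw [zero_add] at h2
  refine h2.congr' ?_
  filter_upwards [hl.eventually_betaVec_ne_zero] with p h0
  rw [innerSL_apply_apply, innerSL_apply_apply, real_inner_self_eq_norm_sq, norm_bVec h0,
    real_inner_comm]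
  simp

theorem LimitLaws.tendsto_psi_sq (hl : LimitLaws β Z δ B μ) (hn : 2 ≤ n) (hX : X ≠ 0)
    (hh : ∀ p, 1 ≤ p → IsPCA (returns β X Z p) (h p)) :
    Tendsto (fun p => psi (returns β X Z p) ^ 2) atTop (𝓝 (psiSqLimit X δ B)) := by
  have hn1 : (n : ℝ) - 1 ≠ 0 := by
    have : (2 : ℝ) ≤ n := by exact_mod_cast hn
    linarith
  have hΛ := hl.topLimit_pos hX
  have hlam := hl.tendsto_scaledTop (by omega) hX hh
  have htr := tendsto_finsetSum (Finset.univ : Finset (Fin n)) fun j _ => hl.tendsto_gram X j j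
  -- The scaled trace tends to `topLimit` + (n - 1)δ², so the remaining eigenvalues average to δ².
  -- Taking the root and squaring it again avoids checking the sign of the radicand at finite p.
  have h1 := (((hlam.sub ((htr.sub hlam).div_const ((n : ℝ) - 1))).div hlam hΛ.ne').sqrt).pow 2
  have h2 : (topLimit X δ B - ((∑ j, (B * (X j * X j) + if j = j then δ ^ 2 else 0))
      - topLimit X δ B) / ((n : ℝ) - 1)) / topLimit X δ B = psiSqLimit X δ B := by
    have h3 : ∑ j, (B * (X j * X j) + if j = j then δ ^ 2 else 0)
        = topLimit X δ B + ((n : ℝ) - 1) * δ ^ 2 := by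
      simp only [if_true, Finset.sum_add_distrib, ← Finset.mul_sum, Finset.sum_const,
        Finset.card_univ, Fintype.card_fin, nsmul_eq_mul, topLimit, sq]
      ring
    rw [h3, add_sub_cancel_left, mul_div_cancel_left₀ _ hn1, psiSqLimit]
    congr 1
    rw [topLimit]; ring
  rw [h2, Real.sq_sqrt (hl.psiSqLimit_pos hX).le] at h1
  refine h1.congr' ?_
  filter_upwards [eventually_ge_atTop 1] with p hp
  rw [psi_eq (by omega) hn]
  simp only [real_inner_self_eq_norm_sq]
  rfl

/-! ### Distance of the MAPS estimator from b -/

theorem norm_smul_add_starProjection_sq {E : Type*} [NormedAddCommGroup E] [InnerProductSpace ℝ E]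
    (K : Submodule ℝ E) [K.HasOrthogonalProjection] {v : E} (hv : ‖v‖ = 1) (τ : ℝ) :
    ‖τ • v + K.starProjection v‖ ^ 2
      = τ ^ 2 + 2 * τ * ‖K.starProjection v‖ ^ 2 + ‖K.starProjection v‖ ^ 2 := by
  have h1 : inner ℝ v (K.starProjection v) = ‖K.starProjection v‖ ^ 2 := by
    have := K.re_inner_starProjection_eq_normSq v
    rw [← real_inner_comm]
    simpa using this
  rw [norm_add_sq_real, norm_smul, hv, inner_smul_left, h1]
  simp only [RCLike.conj_to_real, Real.norm_eq_abs, mul_one, sq_abs]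
  ring

theorem inner_starProjection_self {E : Type*} [NormedAddCommGroup E] [InnerProductSpace ℝ E]
    (K : Submodule ℝ E) [K.HasOrthogonalProjection] (v : E) :
    inner ℝ (K.starProjection v) v = ‖K.starProjection v‖ ^ 2 := by
  simpa using K.re_inner_starProjection_eq_normSq v

theorem norm_normalize_sub {E : Type*} [NormedAddCommGroup E] [InnerProductSpace ℝ E]
    {v b : E} (hv : v ≠ 0) (hb : ‖b‖ = 1) :
    ‖‖v‖⁻¹ • v - b‖ = √(2 - 2 * (inner ℝ v b / ‖v‖)) := by
  rw [← Real.sqrt_sq (norm_nonneg (‖v‖⁻¹ • v - b)), norm_sub_sq_real, norm_smul, norm_inv,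
    norm_norm, inv_mul_cancel₀ (norm_ne_zero_iff.2 hv), hb, inner_smul_left]
  congr 1
  simp only [RCLike.conj_to_real, one_pow]
  ring

/-- The cosine with b depends only on ψ², ‖P h‖², ⟨h, b⟩ and ⟨P h, b⟩; once P kills the noise these
are close to t, tc, √t and √t c with c = ‖P b‖². No convergence of c is required, which is what the
limsup statement needs. -/
theorem LimitLaws.tendsto_norm_maps_sub (hl : LimitLaws β Z δ B μ) (hδ : 0 < δ) (hn : 2 ≤ n)
    (hX : X ≠ 0) (hh : ∀ p, 1 ≤ p → IsPCA (returns β X Z p) (h p))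
    (K : (p : ℕ) → Submodule ℝ (EuclideanSpace ℝ (Fin p)))
    (hK : ∀ j, Tendsto (fun p => ‖(K p).starProjection (noiseVec Z j p)‖ / √p) atTop (𝓝 0)) :
    Tendsto (fun p => ‖maps (returns β X Z p) (h p) (K p) - bVec β p‖
      - √(2 - 2 * √(mapsCosSq (psiSqLimit X δ B) (‖(K p).starProjection (bVec β p)‖ ^ 2))))
      atTop (𝓝 0) := by
  have ht := hl.psiSqLimit_pos hX
  have ht1 := hl.psiSqLimit_lt_one hX hδ
  set t := psiSqLimit X δ B
  have hpb : ∀ p, ‖(K p).starProjection (bVec β p)‖ ≤ 1 := fun p =>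
    ((K p).norm_starProjection_apply_le _).trans (norm_bVec_le β p)
  have hc : ∀ p, ‖(K p).starProjection (bVec β p)‖ ^ 2 ∈ Set.Icc (0 : ℝ) 1 := fun p =>
    ⟨sq_nonneg _, pow_le_one₀ (norm_nonneg _) (hpb p)⟩
  have hdiff := hl.tendsto_map_sub (by omega) hX hh (fun p => (K p).starProjection)
    (fun p => (K p).starProjection_norm_le) hK
  have hst : √t ≤ 1 := Real.sqrt_le_one.2 ht1.le
  have ha : Tendsto (fun p => ‖(K p).starProjection (h p)‖ ^ 2
      - t * ‖(K p).starProjection (bVec β p)‖ ^ 2) atTop (𝓝 0) := by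
    have h1 := hdiff.const_mul 2
    rw [mul_zero] at h1
    refine squeeze_zero_norm' ?_ h1
    filter_upwards [eventually_ge_atTop 1] with p hp
    have h2 : ‖(K p).starProjection (h p)‖ ≤ 1 :=
      ((K p).norm_starProjection_apply_le _).trans (hh p hp).norm_eq_one.le
    have h3 : ‖√t • (K p).starProjection (bVec β p)‖ = √t * ‖(K p).starProjection (bVec β p)‖ := by
      rw [norm_smul, Real.norm_eq_abs, abs_of_nonneg (Real.sqrt_nonneg _)]
    have h4 := abs_norm_sub_norm_le ((K p).starProjection (h p))
      (√t • (K p).starProjection (bVec β p))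
    rw [h3] at h4
    have h5 : ‖(K p).starProjection (h p)‖ ^ 2 - t * ‖(K p).starProjection (bVec β p)‖ ^ 2
        = (‖(K p).starProjection (h p)‖ + √t * ‖(K p).starProjection (bVec β p)‖)
          * (‖(K p).starProjection (h p)‖ - √t * ‖(K p).starProjection (bVec β p)‖) := by
      have h6 := Real.sq_sqrt ht.le
      nth_rewrite 1 [← h6]
      ring
    rw [h5, Real.norm_eq_abs, abs_mul]
    refine mul_le_mul ?_ h4 (abs_nonneg _) zero_le_two
    rw [abs_of_nonneg (by positivity)]
    have := mul_le_one₀ hst (norm_nonneg _) (hpb p)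
    linarith
  have hf : Tendsto (fun p => inner ℝ ((K p).starProjection (h p)) (bVec β p)
      - √t * ‖(K p).starProjection (bVec β p)‖ ^ 2) atTop (𝓝 0) := by
    refine squeeze_zero_norm (fun p => ?_) hdiff
    rw [← inner_starProjection_self, ← real_inner_smul_left, ← inner_sub_left]
    exact (norm_inner_le_norm _ _).trans (mul_le_of_le_one_right (norm_nonneg _) (norm_bVec_le β p))
  have hcos := tendsto_mapsCos_sub ht ht1 hc (hl.tendsto_psi_sq hn hX hh) ha
    (hl.tendsto_inner_bVec (by omega) hX hh) hf
  set C : ℕ → ℝ := fun p => mapsCos (psi (returns β X Z p) ^ 2) (‖(K p).starProjection (h p)‖ ^ 2)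
    (inner ℝ (h p) (bVec β p)) (inner ℝ ((K p).starProjection (h p)) (bVec β p))
  -- Since F ≥ √t > 0 and C - F → 0, the cosine C is eventually positive. This excludes τh + P h =
  -- 0, for which C would be 0 by the convention x / 0 = 0.
  set F : ℕ → ℝ := fun p => √(mapsCosSq t (‖(K p).starProjection (bVec β p)‖ ^ 2))
  have hF : ∀ p, √t ≤ F p := fun p => by
    refine Real.sqrt_le_sqrt ?_
    conv_lhs => rw [← mapsCosSq_zero t]
    exact mapsCosSq_mono ht ht1 (hc p).1 (hc p).2
  have hlim := ((hcos.abs.const_mul 2).sqrt)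
  rw [abs_zero, mul_zero, Real.sqrt_zero] at hlim
  refine squeeze_zero_norm' ?_ hlim
  filter_upwards [eventually_ge_atTop 1, hl.eventually_betaVec_ne_zero,
    hcos.eventually (lt_mem_nhds (neg_neg_of_pos (Real.sqrt_pos.2 ht)))] with p hp h0 hpos
  have hC : 0 < C p := by linarith [hF p]
  have hnorm := norm_smul_add_starProjection_sq (K p) (hh p hp).norm_eq_one
    (tau (returns β X Z p) (h p) (K p))
  have hCeq : C p = inner ℝ (tau (returns β X Z p) (h p) (K p) • h p + (K p).starProjection (h p))
      (bVec β p) / ‖tau (returns β X Z p) (h p) (K p) • h p + (K p).starProjection (h p)‖ := by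
    rw [← Real.sqrt_sq (norm_nonneg (tau (returns β X Z p) (h p) (K p) • h p
      + (K p).starProjection (h p))), hnorm, inner_add_left, real_inner_smul_left]
    rfl
  have hv : tau (returns β X Z p) (h p) (K p) • h p + (K p).starProjection (h p) ≠ 0 := by
    intro h1
    rw [h1] at hCeq
    simp at hCeq
    exact hC.ne' hCeq
  rw [maps, norm_normalize_sub hv (norm_bVec h0), ← hCeq, Real.norm_eq_abs]
  refine (abs_sqrt_sub_sqrt_le _ _).trans (Real.sqrt_le_sqrt ?_)
  have h7 : 2 - 2 * C p - (2 - 2 * F p) = -(2 * (C p - F p)) := by ring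
  rw [h7, abs_neg, abs_mul, abs_two]

theorem LimitLaws.tendsto_norm_pca_sub (hl : LimitLaws β Z δ B μ) (hn : n ≠ 0)
    (hX : X ≠ 0) (hh : ∀ p, 1 ≤ p → IsPCA (returns β X Z p) (h p)) :
    Tendsto (fun p => ‖h p - bVec β p‖) atTop (𝓝 √(2 - 2 * √(psiSqLimit X δ B))) := by
  refine (((hl.tendsto_inner_bVec hn hX hh).const_mul 2).const_sub 2).sqrt.congr' ?_
  filter_upwards [eventually_ge_atTop 1, hl.eventually_betaVec_ne_zero] with p hp h0
  have h1 := (hh p hp).norm_eq_one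
  have h2 := norm_normalize_sub (norm_ne_zero_iff.1 (h1.trans_ne one_ne_zero)) (norm_bVec h0)
  rw [h1, inv_one, one_smul, div_one] at h2
  exact h2.symm

end

/-! ### Projections onto frame subspaces and onto their sum with q -/

/-- The `i`-th column of an orthogonal matrix, as a vector of the Euclidean space. -/
def frame {p : ℕ} (g : Matrix.orthogonalGroup (Fin p) ℝ) (i : Fin p) : EuclideanSpace ℝ (Fin p) :=
  WithLp.toLp 2 (fun l => (g : Matrix (Fin p) (Fin p) ℝ) l i)

theorem toEuclideanLin_single {p : ℕ} (g : Matrix.orthogonalGroup (Fin p) ℝ) (i : Fin p) :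
    (g : Matrix (Fin p) (Fin p) ℝ).toEuclideanLin (EuclideanSpace.single i 1) = frame g i := by
  ext l
  simp [frame, Matrix.ofLp_toLpLin, Matrix.toLin'_apply]

theorem inner_frame {p : ℕ} (g : Matrix.orthogonalGroup (Fin p) ℝ) (i j : Fin p) :
    inner ℝ (frame g i) (frame g j) = if i = j then 1 else 0 := by
  have h := congrFun (congrFun ((Matrix.mem_orthogonalGroup_iff' _ _).1 g.2) i) j
  rw [Matrix.mul_apply, Matrix.one_apply] at h
  rw [inner_eq_sum, ← h]
  rfl

theorem norm_frame {p : ℕ} (g : Matrix.orthogonalGroup (Fin p) ℝ) (i : Fin p) :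
    ‖frame g i‖ = 1 := by
  have h := inner_frame g i i
  rw [if_pos rfl, real_inner_self_eq_norm_sq] at h
  exact (pow_eq_one_iff_of_nonneg (norm_nonneg _) two_ne_zero).1 h

theorem frame_mem {p k : ℕ} (g : Matrix.orthogonalGroup (Fin p) ℝ) {i : Fin p}
    (hi : (i : ℕ) < k) : frame g i ∈ subspaceOf g k :=
  Submodule.subset_span ⟨i, hi, (toEuclideanLin_single g i).symm⟩

theorem starProjection_subspaceOf {p : ℕ} (g : Matrix.orthogonalGroup (Fin p) ℝ) (k : ℕ)
    (v : EuclideanSpace ℝ (Fin p)) :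
    (subspaceOf g k).starProjection v
      = ∑ i ∈ Finset.univ.filter (fun i : Fin p => (i : ℕ) < k), (inner ℝ (frame g i) v : ℝ) • frame g i := by
  refine Submodule.eq_starProjection_of_mem_of_inner_eq_zero ?_ ?_
  · refine Submodule.sum_mem _ fun i hi => Submodule.smul_mem _ _ (frame_mem g ?_)
    simpa using hi
  · intro w hw
    refine Submodule.span_induction ?_ (inner_zero_right _) ?_ ?_ hw
    · rintro _ ⟨j, hj, rfl⟩
      rw [toEuclideanLin_single, inner_sub_left, sum_inner]
      simp only [real_inner_smul_left, inner_frame, mul_ite, mul_one, mul_zero]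
      rw [Finset.sum_ite_eq', if_pos (by simpa using hj), real_inner_comm, sub_self]
    · intro x y _ _ hx hy
      rw [inner_add_right, hx, hy, add_zero]
    · intro a x _ hx
      rw [inner_smul_right, hx, mul_zero]

theorem norm_sq_starProjection_subspaceOf {p : ℕ} (g : Matrix.orthogonalGroup (Fin p) ℝ) (k : ℕ)
    (v : EuclideanSpace ℝ (Fin p)) :
    ‖(subspaceOf g k).starProjection v‖ ^ 2
      = ∑ i ∈ Finset.univ.filter (fun i : Fin p => (i : ℕ) < k), (inner ℝ (frame g i) v) ^ 2 := by
  rw [← inner_starProjection_self, starProjection_subspaceOf, sum_inner]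
  refine Finset.sum_congr rfl fun i _ => ?_
  rw [real_inner_smul_left, sq]

section

variable {E : Type*} [NormedAddCommGroup E] [InnerProductSpace ℝ E]

/-- The normalised component of `q` orthogonal to `K`. -/
noncomputable def unitResidual (K : Submodule ℝ E) [K.HasOrthogonalProjection] (q : E) : E :=
  ‖q - K.starProjection q‖⁻¹ • (q - K.starProjection q)

variable (K : Submodule ℝ E) [K.HasOrthogonalProjection]

theorem norm_unitResidual_le (q : E) : ‖unitResidual K q‖ ≤ 1 := by
  rw [unitResidual, norm_smul, norm_inv, norm_norm]
  exact inv_mul_le_one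

theorem inner_unitResidual_of_mem (q : E) {w : E} (hw : w ∈ K) : inner ℝ (unitResidual K q) w = 0 := by
  rw [unitResidual, real_inner_smul_left, K.starProjection_inner_eq_zero q w hw, mul_zero]

/-- Adjoining q adds the single direction orthogonal to K in the enlarged space. If q already lies
in K, `unitResidual` is 0 and the formula stays correct. -/
theorem starProjection_sup_span (q z : E) [(K ⊔ Submodule.span ℝ {q}).HasOrthogonalProjection] :
    (K ⊔ Submodule.span ℝ {q}).starProjection z
      = K.starProjection z + (inner ℝ (unitResidual K q) z : ℝ) • unitResidual K q := by
  have hq : q - K.starProjection q ∈ K ⊔ Submodule.span ℝ {q} :=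
    Submodule.sub_mem _ (Submodule.mem_sup_right (Submodule.mem_span_singleton_self q))
      (Submodule.mem_sup_left (K.starProjection_apply_mem q))
  -- The residual has norm 1 or 0; multiplying by ‖q - P q‖ gives an identity that holds in both
  -- cases.
  have hself : inner ℝ (unitResidual K q) (unitResidual K q) * ‖q - K.starProjection q‖
      = ‖q - K.starProjection q‖ := by
    by_cases h0 : q - K.starProjection q = 0
    · simp [h0]
    · rw [unitResidual, real_inner_self_eq_norm_sq, norm_smul, norm_inv, norm_norm,
        inv_mul_cancel₀ (norm_ne_zero_iff.2 h0)]
      ring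
  have hr : q = K.starProjection q + ‖q - K.starProjection q‖ • unitResidual K q := by
    by_cases h0 : q - K.starProjection q = 0
    · rw [h0]; simpa using sub_eq_zero.1 h0
    · rw [unitResidual, smul_smul, mul_inv_cancel₀ (norm_ne_zero_iff.2 h0), one_smul]
      abel
  refine Submodule.eq_starProjection_of_mem_of_inner_eq_zero ?_ ?_
  · refine Submodule.add_mem _ (Submodule.mem_sup_left (K.starProjection_apply_mem z)) ?_
    exact Submodule.smul_mem _ _ (Submodule.smul_mem _ _ hq)
  · intro w hw
    obtain ⟨w1, hw1, w2, hw2, rfl⟩ := Submodule.mem_sup.1 hw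
    obtain ⟨a, rfl⟩ := Submodule.mem_span_singleton.1 hw2
    have hK : ∀ u ∈ K, inner ℝ (z - (K.starProjection z
        + (inner ℝ (unitResidual K q) z : ℝ) • unitResidual K q)) u = 0 := fun u hu => by
      rw [← sub_sub, inner_sub_left, K.starProjection_inner_eq_zero z u hu, real_inner_smul_left,
        inner_unitResidual_of_mem K q hu]
      simp
    have hres : inner ℝ (z - (K.starProjection z
        + (inner ℝ (unitResidual K q) z : ℝ) • unitResidual K q)) (‖q - K.starProjection q‖ • unitResidual K q)
        = 0 := by
      rw [real_inner_smul_right, inner_sub_left, inner_add_left, real_inner_smul_left,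
        real_inner_comm (unitResidual K q) (K.starProjection z),
        inner_unitResidual_of_mem K q (K.starProjection_apply_mem z), real_inner_comm z (unitResidual K q)]
      linear_combination (-inner ℝ z (unitResidual K q)) * hself
    rw [inner_add_right, hK w1 hw1, zero_add, real_inner_smul_right]
    conv_lhs => enter [2, 3]; rw [hr]
    rw [inner_add_right, hK _ (K.starProjection_apply_mem q), hres, add_zero, mul_zero]

theorem norm_sq_starProjection_sup_span (q z : E)
    [(K ⊔ Submodule.span ℝ {q}).HasOrthogonalProjection] :
    ‖(K ⊔ Submodule.span ℝ {q}).starProjection z‖ ^ 2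
      = ‖K.starProjection z‖ ^ 2 + (inner ℝ (unitResidual K q) z) ^ 2 := by
  rw [← inner_starProjection_self, starProjection_sup_span, inner_add_left,
    inner_starProjection_self, real_inner_smul_left, sq (inner ℝ _ _)]

end

theorem norm_qVec {p : ℕ} (hp : 1 ≤ p) : ‖qVec p‖ = 1 := by
  have h : ‖qVec p‖ ^ 2 = 1 := by
    have hp0 : (0 : ℝ) < p := by exact_mod_cast hp
    rw [norm_sq_eq_sum]
    simp [qVec, Real.sq_sqrt hp0.le, hp0.ne']
  exact (pow_eq_one_iff_of_nonneg (norm_nonneg _) two_ne_zero).1 h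

theorem norm_sq_starProjection_qSpan {p : ℕ} (hp : 1 ≤ p) (v : EuclideanSpace ℝ (Fin p)) :
    ‖(qSpan p).starProjection v‖ ^ 2 = (inner ℝ (qVec p) v) ^ 2 := by
  rw [qSpan, Submodule.starProjection_unit_singleton ℝ (norm_qVec hp), norm_smul, norm_qVec hp,
    mul_one, Real.norm_eq_abs, sq_abs]

theorem norm_starProjection_le_of_le {E : Type*} [NormedAddCommGroup E] [InnerProductSpace ℝ E]
    {K K' : Submodule ℝ E} [K.HasOrthogonalProjection] [K'.HasOrthogonalProjection] (h : K ≤ K')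
    (v : E) : ‖K.starProjection v‖ ≤ ‖K'.starProjection v‖ := by
  rw [← Submodule.starProjection_comp_starProjection_of_le h]
  exact K.norm_starProjection_apply_le _

/-! ### The deterministic conclusion -/

section

variable {n : ℕ} {β : ℕ → ℝ} {X : Fin n → ℝ} {Z : ℕ → Fin n → ℝ} {δ B μ : ℝ}
  {h : (p : ℕ) → EuclideanSpace ℝ (Fin p)}

theorem LimitLaws.tendsto_inner_qVec_bVec (hl : LimitLaws β Z δ B μ) :
    Tendsto (fun p => inner ℝ (qVec p) (bVec β p)) atTop (𝓝 (μ / √B)) := by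
  refine (hl.beta_q.div hl.tendsto_norm_beta (Real.sqrt_pos.2 hl.B_pos).ne').congr' ?_
  filter_upwards [eventually_ge_atTop 1, hl.eventually_betaVec_ne_zero] with p hp h0
  have hp0 : 0 < √(p : ℝ) := Real.sqrt_pos.2 (by exact_mod_cast hp)
  have h2 := norm_ne_zero_iff.2 h0
  rw [Pi.div_apply, bVec, inner_smul_right, real_inner_comm (qVec p)]
  field_simp

/-- The component of q orthogonal to H has squared norm 1 - ‖P_H q‖² → 1 and the same limiting inner
product with b as q; the part of b inside H disappears. -/
theorem tendsto_norm_sq_starProjection_sup_qSpan {b : (p : ℕ) → EuclideanSpace ℝ (Fin p)}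
    {a : ℝ} (hb1 : ∀ p, ‖b p‖ ≤ 1) (hqb : Tendsto (fun p => inner ℝ (qVec p) (b p)) atTop (𝓝 a))
    (H : (p : ℕ) → Submodule ℝ (EuclideanSpace ℝ (Fin p)))
    (hHb : Tendsto (fun p => ‖(H p).starProjection (b p)‖) atTop (𝓝 0))
    (hHq : Tendsto (fun p => ‖(H p).starProjection (qVec p)‖) atTop (𝓝 0)) :
    Tendsto (fun p => ‖(H p ⊔ qSpan p).starProjection (b p)‖ ^ 2) atTop (𝓝 (a ^ 2)) := by
  have hcH : Tendsto (fun p => ‖(H p).starProjection (b p)‖ ^ 2) atTop (𝓝 0) := by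
    simpa using hHb.pow 2
  have hr : Tendsto (fun p => ‖qVec p - (H p).starProjection (qVec p)‖ ^ 2) atTop (𝓝 1) := by
    have h1 := (hHq.pow 2).const_sub 1
    simp only [ne_eq, OfNat.ofNat_ne_zero, not_false_eq_true, zero_pow, sub_zero] at h1
    refine h1.congr' ?_
    filter_upwards [eventually_ge_atTop 1] with p hp
    rw [norm_sub_sq_real, norm_qVec hp, ← real_inner_comm, inner_starProjection_self]
    ring
  have hi : Tendsto (fun p => inner ℝ (qVec p - (H p).starProjection (qVec p)) (b p)) atTop
      (𝓝 a) := by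
    have h1 : Tendsto (fun p => inner ℝ ((H p).starProjection (qVec p)) (b p)) atTop
        (𝓝 0) := by
      refine squeeze_zero_norm (fun p => ?_) hHq
      exact (norm_inner_le_norm _ _).trans
        (mul_le_of_le_one_right (norm_nonneg _) (hb1 p))
    have h2 := hqb.sub h1
    rw [sub_zero] at h2
    exact h2.congr fun p => (inner_sub_left _ _ _).symm
  have h3 := hcH.add ((hi.pow 2).div hr one_ne_zero)
  rw [zero_add, div_one] at h3
  refine h3.congr fun p => ?_
  rw [qSpan, norm_sq_starProjection_sup_span, unitResidual, real_inner_smul_left, mul_pow, inv_pow,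
    Pi.div_apply]
  ring

theorem LimitLaws.tendsto_norm_maps_sub_of_tendsto (hl : LimitLaws β Z δ B μ) (hδ : 0 < δ)
    (hn : 2 ≤ n) (hX : X ≠ 0) (hh : ∀ p, 1 ≤ p → IsPCA (returns β X Z p) (h p))
    (K : (p : ℕ) → Submodule ℝ (EuclideanSpace ℝ (Fin p))) {d : ℝ} (hd : d ≤ 1)
    (hK : ∀ j, Tendsto (fun p => ‖(K p).starProjection (noiseVec Z j p)‖ / √p) atTop (𝓝 0))
    (hKd : Tendsto (fun p => ‖(K p).starProjection (bVec β p)‖ ^ 2) atTop (𝓝 d)) :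
    Tendsto (fun p => ‖maps (returns β X Z p) (h p) (K p) - bVec β p‖) atTop
      (𝓝 √(2 - 2 * √(mapsCosSq (psiSqLimit X δ B) d))) := by
  have h1 := hl.tendsto_norm_maps_sub hδ hn hX hh K hK
  have h2 := (((tendsto_mapsCosSq (hl.psiSqLimit_pos hX) (hl.psiSqLimit_lt_one hX hδ) hd
    hKd).sqrt.const_mul 2).const_sub 2).sqrt
  have h3 := h1.add h2
  rw [zero_add] at h3
  exact h3.congr fun p => by ring

theorem limsup_le_of_tendsto_sub {u v w : ℕ → ℝ} {a : ℝ} (hu : ∀ p, 0 ≤ u p)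
    (huv : Tendsto (fun p => u p - v p) atTop (𝓝 0)) (hvw : ∀ p, v p ≤ w p)
    (hw : Tendsto w atTop (𝓝 a)) : limsup u atTop ≤ a := by
  have h2 := huv.add hw
  rw [zero_add] at h2
  rw [← h2.limsup_eq]
  refine limsup_le_limsup (Eventually.of_forall fun p => ?_) ?_ h2.isBoundedUnder_le
  · dsimp only
    linarith [hvw p]
  -- A real-valued `limsup` compares only for suitably bounded sequences; nonnegativity of u
  -- supplies the bound.
  · exact isCoboundedUnder_le_of_le atTop (x := 0) hu

theorem LimitLaws.conclusion (hl : LimitLaws β Z δ B μ) (hδ : 0 < δ) (hn : 2 ≤ n)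
    (hX : X ≠ 0) (hh : ∀ p, 1 ≤ p → IsPCA (returns β X Z p) (h p))
    (L H : (p : ℕ) → Submodule ℝ (EuclideanSpace ℝ (Fin p)))
    (hL : ∀ j, Tendsto (fun p => ‖(L p ⊔ qSpan p).starProjection (noiseVec Z j p)‖ / √p)
      atTop (𝓝 0))
    (hH : ∀ j, Tendsto (fun p => ‖(H p ⊔ qSpan p).starProjection (noiseVec Z j p)‖ / √p)
      atTop (𝓝 0))
    (hHb : Tendsto (fun p => ‖(H p).starProjection (bVec β p)‖) atTop (𝓝 0))
    (hHq : Tendsto (fun p => ‖(H p).starProjection (qVec p)‖) atTop (𝓝 0)) :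
    ∃ errGPS errPCA : ℝ,
      Tendsto (fun p => ‖gps (returns β X Z p) (h p) - bVec β p‖) atTop (𝓝 errGPS) ∧
      Tendsto (fun p => ‖h p - bVec β p‖) atTop (𝓝 errPCA) ∧
      limsup (fun p => ‖maps (returns β X Z p) (h p) (L p ⊔ qSpan p) - bVec β p‖) atTop ≤ errGPS ∧
      Tendsto (fun p => ‖maps (returns β X Z p) (h p) (H p ⊔ qSpan p) - bVec β p‖) atTop
        (𝓝 errGPS) ∧
      Tendsto (fun p => ‖maps (returns β X Z p) (h p) (H p) - bVec β p‖) atTop (𝓝 errPCA) := by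
  have ht := hl.psiSqLimit_pos hX
  have ht1 := hl.psiSqLimit_lt_one hX hδ
  -- Vanishing of the projected noise passes to smaller subspaces, so span{q} and H inherit it from
  -- span{L, q} and span{H, q}.
  have hmono : ∀ K K' : (p : ℕ) → Submodule ℝ (EuclideanSpace ℝ (Fin p)), (∀ p, K p ≤ K' p) →
      (∀ j, Tendsto (fun p => ‖(K' p).starProjection (noiseVec Z j p)‖ / √p) atTop (𝓝 0)) →
      ∀ j, Tendsto (fun p => ‖(K p).starProjection (noiseVec Z j p)‖ / √p) atTop (𝓝 0) := by
    intro K K' hKK' hK' j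
    refine squeeze_zero (fun p => by positivity) (fun p => ?_) (hK' j)
    have := norm_starProjection_le_of_le (hKK' p) (noiseVec Z j p)
    gcongr
  have hqn := hmono qSpan _ (fun p => le_sup_right) hL
  have hHn := hmono H _ (fun p => le_sup_left) hH
  set c := (μ / √B) ^ 2
  have hcq : Tendsto (fun p => ‖(qSpan p).starProjection (bVec β p)‖ ^ 2) atTop (𝓝 c) := by
    refine (hl.tendsto_inner_qVec_bVec.pow 2).congr' ?_
    filter_upwards [eventually_ge_atTop 1] with p hp
    rw [norm_sq_starProjection_qSpan hp]
  have hle1 : ∀ (K : (p : ℕ) → Submodule ℝ (EuclideanSpace ℝ (Fin p))) (p : ℕ),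
      ‖(K p).starProjection (bVec β p)‖ ^ 2 ≤ 1 := fun K p =>
    pow_le_one₀ (norm_nonneg _) (((K p).norm_starProjection_apply_le _).trans (norm_bVec_le β p))
  have hc1 : c ≤ 1 := le_of_tendsto' hcq (hle1 qSpan)
  have hcH : Tendsto (fun p => ‖(H p).starProjection (bVec β p)‖ ^ 2) atTop (𝓝 0) := by
    simpa using hHb.pow 2
  have hcHq := tendsto_norm_sq_starProjection_sup_qSpan (norm_bVec_le β)
    hl.tendsto_inner_qVec_bVec H hHb hHq
  refine ⟨_, _, hl.tendsto_norm_maps_sub_of_tendsto hδ hn hX hh qSpan hc1 hqn hcq,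
    hl.tendsto_norm_pca_sub (by omega) hX hh, ?_,
    hl.tendsto_norm_maps_sub_of_tendsto hδ hn hX hh _ hc1 hH hcHq, ?_⟩
  · refine limsup_le_of_tendsto_sub (fun p => norm_nonneg _)
      (hl.tendsto_norm_maps_sub hδ hn hX hh _ hL) (fun p => ?_)
      (((tendsto_mapsCosSq ht ht1 hc1 hcq).sqrt.const_mul 2).const_sub 2).sqrt
    have h4 : ‖(qSpan p).starProjection (bVec β p)‖ ^ 2
        ≤ ‖(L p ⊔ qSpan p).starProjection (bVec β p)‖ ^ 2 :=
      pow_le_pow_left₀ (norm_nonneg _) (norm_starProjection_le_of_le le_sup_right _) 2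
    have h5 := Real.sqrt_le_sqrt (mapsCosSq_mono ht ht1 h4 (hle1 (fun p => L p ⊔ qSpan p) p))
    exact Real.sqrt_le_sqrt (sub_le_sub_left (mul_le_mul_of_nonneg_left h5 zero_le_two) 2)
  · have h1 := hl.tendsto_norm_maps_sub_of_tendsto hδ hn hX hh H zero_le_one hHn hcH
    rwa [mapsCosSq_zero] at h1

end

/-! ### A strong law of large numbers from second moments -/

section

variable {Ω : Type*} [MeasurableSpace Ω] {P : Measure Ω}

/-- Nonnegative random variables with summable expectations tend to zero almost surely. -/
theorem ae_tendsto_zero_of_summable {f : ℕ → Ω → ℝ} {a : ℕ → ℝ}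
    (hf : ∀ m, AEMeasurable (f m) P) (hf0 : ∀ m ω, 0 ≤ f m ω) (ha0 : ∀ m, 0 ≤ a m)
    (ha : Summable a) (h : ∀ m, ∫⁻ ω, ENNReal.ofReal (f m ω) ∂P ≤ ENNReal.ofReal (a m)) :
    ∀ᵐ ω ∂P, Tendsto (fun m => f m ω) atTop (𝓝 0) := by
  have h1 : ∑' m, ∫⁻ ω, ENNReal.ofReal (f m ω) ∂P ≠ ⊤ := by
    refine ne_top_of_le_ne_top ?_ (ENNReal.tsum_le_tsum h)
    rw [← ENNReal.ofReal_tsum_of_nonneg ha0 ha]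
    exact ENNReal.ofReal_ne_top
  rw [← lintegral_tsum fun m => (hf m).ennreal_ofReal] at h1
  filter_upwards [ae_lt_top' (AEMeasurable.tsum fun m => (hf m).ennreal_ofReal) h1]
    with ω hω
  have h2 := ENNReal.tendsto_atTop_zero_of_tsum_ne_top hω.ne
  have h3 := (ENNReal.tendsto_toReal ENNReal.zero_ne_top).comp h2
  simpa [Function.comp_def, ENNReal.toReal_ofReal, hf0] using h3

theorem integral_sum_sq_le {ι : Type*} {Y : ι → Ω → ℝ} {C : ℝ} (hY : ∀ i, MemLp (Y i) 2 P)
    (horth : ∀ i j, i ≠ j → ∫ ω, Y i ω * Y j ω ∂P = 0) (hC : ∀ i, ∫ ω, Y i ω ^ 2 ∂P ≤ C)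
    (s : Finset ι) : ∫ ω, (∑ i ∈ s, Y i ω) ^ 2 ∂P ≤ s.card * C := by
  classical
  have hint : ∀ i j, Integrable (fun ω => Y i ω * Y j ω) P := fun i j =>
    (hY i).integrable_mul (hY j)
  have h1 : ∫ ω, (∑ i ∈ s, Y i ω) ^ 2 ∂P = ∑ i ∈ s, ∑ j ∈ s, ∫ ω, Y i ω * Y j ω ∂P := by
    simp only [sq, Finset.sum_mul_sum]
    rw [integral_finsetSum _ fun i _ => integrable_finsetSum _ fun j _ => hint i j]
    exact Finset.sum_congr rfl fun i _ => integral_finsetSum _ fun j _ => hint i j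
  rw [h1, ← nsmul_eq_mul]
  refine Finset.sum_le_card_nsmul _ _ _ fun i hi => ?_
  rw [Finset.sum_eq_single_of_mem i hi fun j _ hj => horth i j hj.symm]
  simpa only [sq] using hC i

/-- The strong law of large numbers for orthogonal random variables with bounded second
moments. -/
theorem ae_tendsto_average_of_orthogonal {Y : ℕ → Ω → ℝ} {C : ℝ} (hY : ∀ i, MemLp (Y i) 2 P)
    (horth : ∀ i j, i ≠ j → ∫ ω, Y i ω * Y j ω ∂P = 0) (hC : ∀ i, ∫ ω, Y i ω ^ 2 ∂P ≤ C) :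
    ∀ᵐ ω ∂P, Tendsto (fun p : ℕ => (∑ i ∈ Finset.range p, Y i ω) / p) atTop (𝓝 0) := by
  have hC0 : 0 ≤ C := (integral_nonneg fun ω => sq_nonneg (Y 0 ω)).trans (hC 0)
  set T : Finset ℕ → Ω → ℝ := fun s ω => (∑ i ∈ s, Y i ω) ^ 2
  have hTint : ∀ s, Integrable (T s) P := fun s =>
    (memLp_finsetSum (p := 2) s fun i _ => hY i).integrable_sq
  have hT : ∀ s : Finset ℕ, ∫⁻ ω, ENNReal.ofReal (T s ω) ∂P ≤ ENNReal.ofReal (s.card * C) :=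
    fun s => by
      rw [← ofReal_integral_eq_lintegral_ofReal (hTint s) (ae_of_all _ fun ω => sq_nonneg _)]
      exact ENNReal.ofReal_le_ofReal (integral_sum_sq_le hY horth hC s)
  -- V controls the partial sum at m² and all sums over blocks starting there, up to the next
  -- square. Summing over the blocks replaces a maximal inequality: the expectation is at most (m² +
  -- (2m + 1) 2m) C / m⁴, hence at most 10 C / m², which is summable.
  set V : ℕ → Ω → ℝ := fun m ω => (T (Finset.range (m ^ 2)) ω
    + ∑ r ∈ Finset.range (2 * m + 1), T (Finset.Ico (m ^ 2) (m ^ 2 + r)) ω) / (m : ℝ) ^ 4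
  have hV0 : ∀ m ω, 0 ≤ V m ω := fun m ω =>
    div_nonneg (add_nonneg (sq_nonneg _) (Finset.sum_nonneg fun r _ => sq_nonneg _)) (by positivity)
  have hVint : ∀ m, Integrable (V m) P := fun m =>
    ((hTint _).add (integrable_finsetSum _ fun r _ => hTint _)).div_const _
  have hV : ∀ m, ∫⁻ ω, ENNReal.ofReal (V m ω) ∂P ≤ ENNReal.ofReal (10 * C * (1 / (m : ℝ) ^ 2)) := by
    intro m
    rw [← ofReal_integral_eq_lintegral_ofReal (hVint m) (ae_of_all _ (hV0 m))]
    refine ENNReal.ofReal_le_ofReal ?_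
    rcases Nat.eq_zero_or_pos m with rfl | hm
    · simp [V]
    have hm1 : (1 : ℝ) ≤ m := by exact_mod_cast hm
    simp only [V]
    rw [integral_div, integral_add (hTint _) (integrable_finsetSum _ fun r _ => hTint _),
      integral_finsetSum _ fun r _ => hTint _]
    have h1 := integral_sum_sq_le hY horth hC (Finset.range (m ^ 2))
    have h2 : ∑ r ∈ Finset.range (2 * m + 1), ∫ ω, T (Finset.Ico (m ^ 2) (m ^ 2 + r)) ω ∂P
        ≤ (2 * m + 1 : ℕ) • ((2 * m : ℝ) * C) := by
      refine (Finset.sum_le_card_nsmul _ _ ((2 * m : ℝ) * C) fun r hr => ?_).trans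
        (by rw [Finset.card_range])
      refine (integral_sum_sq_le hY horth hC _).trans ?_
      rw [Nat.card_Ico, Nat.add_sub_cancel_left]
      refine mul_le_mul_of_nonneg_right ?_ hC0
      have : r ≤ 2 * m := by have := Finset.mem_range.1 hr; omega
      exact_mod_cast this
    rw [Finset.card_range] at h1
    rw [div_le_iff₀ (by positivity)]
    have h3 : 10 * C * (1 / (m : ℝ) ^ 2) * (m : ℝ) ^ 4 = 10 * C * (m : ℝ) ^ 2 := by
      field_simp
    rw [h3]
    rw [nsmul_eq_mul] at h2
    push_cast at h1 h2
    nlinarith [mul_nonneg hC0 (sub_nonneg.2 hm1), mul_nonneg (mul_nonneg hC0 (sub_nonneg.2 hm1))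
      (by linarith : (0 : ℝ) ≤ m)]
  have hae := ae_tendsto_zero_of_summable (fun m => (hVint m).aestronglyMeasurable.aemeasurable) hV0
    (fun m => by positivity) ((Real.summable_one_div_nat_pow.2 one_lt_two).mul_left (10 * C)) hV
  filter_upwards [hae] with ω hω
  have hsqrt : Tendsto Nat.sqrt atTop atTop :=
    tendsto_atTop_atTop.2 fun b => ⟨b ^ 2, fun a ha => Nat.le_sqrt'.2 ha⟩
  have h1 := ((hω.comp hsqrt).sqrt).const_mul 2
  rw [Real.sqrt_zero, mul_zero] at h1
  refine squeeze_zero_norm' ?_ h1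
  filter_upwards [eventually_ge_atTop 1] with p hp
  -- As m² ≤ p < (m + 1)², the block from m² to p has length at most 2m. Both pieces of the sum are
  -- at most √(V m) m², and m² ≤ p.
  set m := Nat.sqrt p
  have hm : 1 ≤ m := Nat.le_sqrt'.2 (by simpa using hp)
  have hm0 : (0 : ℝ) < m := by exact_mod_cast hm
  have hmp : m ^ 2 ≤ p := Nat.sqrt_le' p
  have hpm : p < (m + 1) ^ 2 := Nat.lt_succ_sqrt' p
  have hsum : ∑ i ∈ Finset.range p, Y i ω = ∑ i ∈ Finset.range (m ^ 2), Y i ω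
      + ∑ i ∈ Finset.Ico (m ^ 2) (m ^ 2 + (p - m ^ 2)), Y i ω := by
    rw [Nat.add_sub_cancel' hmp, Finset.sum_range_add_sum_Ico _ hmp]
  have hVm : V m ω * (m : ℝ) ^ 4 = T (Finset.range (m ^ 2)) ω
    + ∑ r ∈ Finset.range (2 * m + 1), T (Finset.Ico (m ^ 2) (m ^ 2 + r)) ω := by
    simp only [V]; rw [div_mul_cancel₀ _ (by positivity)]
  have hT0 : ∀ s, 0 ≤ T s ω := fun s => sq_nonneg _
  have hsqrtV : √(V m ω) * (m : ℝ) ^ 2 = √(V m ω * (m : ℝ) ^ 4) := by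
    rw [Real.sqrt_mul (hV0 m ω)]
    congr 1
    rw [show (m : ℝ) ^ 4 = ((m : ℝ) ^ 2) ^ 2 by ring, Real.sqrt_sq (by positivity)]
  have ha : |∑ i ∈ Finset.range (m ^ 2), Y i ω| ≤ √(V m ω) * (m : ℝ) ^ 2 := by
    rw [hsqrtV]
    refine Real.abs_le_sqrt ?_
    rw [hVm]
    exact le_add_of_nonneg_right (Finset.sum_nonneg fun r _ => hT0 _)
  have hb : |∑ i ∈ Finset.Ico (m ^ 2) (m ^ 2 + (p - m ^ 2)), Y i ω| ≤ √(V m ω) * (m : ℝ) ^ 2 := by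
    rw [hsqrtV]
    refine Real.abs_le_sqrt ?_
    rw [hVm]
    refine le_add_of_nonneg_of_le (hT0 _) ?_
    refine Finset.single_le_sum (f := fun r => T (Finset.Ico (m ^ 2) (m ^ 2 + r)) ω)
      (fun r _ => hT0 _) (Finset.mem_range.2 ?_)
    have h9 : (m + 1) ^ 2 = m ^ 2 + 2 * m + 1 := by ring
    omega
  have hp0 : (0 : ℝ) < p := by exact_mod_cast hp
  rw [hsum, Real.norm_eq_abs, abs_div, abs_of_pos hp0, div_le_iff₀ hp0]
  have hmp' : (m : ℝ) ^ 2 ≤ p := by exact_mod_cast hmp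
  calc _ ≤ √(V m ω) * (m : ℝ) ^ 2 + √(V m ω) * (m : ℝ) ^ 2 :=
        (abs_add_le _ _).trans (add_le_add ha hb)
    _ = 2 * √(V m ω) * (m : ℝ) ^ 2 := by ring
    _ ≤ 2 * √(V m ω) * p := by gcongr

end

/-! ### Moments of the noise and the almost sure limit laws -/

section

variable {Ω : Type*} [MeasurableSpace Ω] {P : Measure Ω} {n : ℕ} {Z : ℕ → Fin n → Ω → ℝ} {δ : ℝ}
  {β : ℕ → Ω → ℝ} {X : Fin n → Ω → ℝ}

theorem integrable_pow_four_of_memLp {W : Ω → ℝ} (hW : MemLp W 4 P) :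
    Integrable (fun ω => W ω ^ 4) P := by
  have h := MemLp.integrable_norm_pow (p := 4) (by exact_mod_cast hW) (by norm_num)
  refine h.congr (ae_of_all _ fun ω => ?_)
  simp only [Real.norm_eq_abs]
  exact Even.pow_abs (by decide) _

theorem integral_noise_sq (hZ : RegularZ P Z δ) (i : ℕ) (j : Fin n) :
    ∫ ω, Z i j ω ^ 2 ∂P = δ ^ 2 := by
  rw [← hZ.variance_eq i j,
    variance_of_integral_eq_zero (hZ.measurable i j).aemeasurable (hZ.mean_zero i j)]

theorem indepFun_noise (hZ : RegularZ P Z δ) {i l : ℕ} (hil : i ≠ l) {f g : (Fin n → ℝ) → ℝ}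
    (hf : Measurable f) (hg : Measurable g) :
    IndepFun (fun ω => f fun j => Z i j ω) (fun ω => g fun j => Z l j ω) P :=
  (hZ.rows_indep.indepFun hil).comp hf hg

variable [IsProbabilityMeasure P]

theorem integrable_pow_of_le_four {W : Ω → ℝ} (hm : AEStronglyMeasurable W P)
    (hW : Integrable (fun ω => W ω ^ 4) P) {k : ℕ} (hk : k ≤ 4) :
    Integrable (fun ω => W ω ^ k) P := by
  refine ((integrable_const (1 : ℝ)).add hW).mono' (hm.pow k) (ae_of_all _ fun ω => ?_)
  rw [norm_pow, Real.norm_eq_abs, Pi.add_apply, ← Even.pow_abs (by decide : Even 4) (W ω)]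
  rcases le_total |W ω| 1 with h | h
  · have := pow_le_one₀ (n := k) (abs_nonneg _) h
    have : 0 ≤ |W ω| ^ 4 := by positivity
    linarith
  · have := pow_le_pow_right₀ h hk
    linarith

/-- A fourth moment bound for sums of independent centred random variables. -/
theorem integral_sum_pow_four_le {ι : Type*} {V : ι → Ω → ℝ} {a : ι → ℝ} {D M : ℝ}
    (hD : 0 ≤ D) (hDM : D ^ 2 ≤ M)
    (hind : iIndepFun V P) (hm : ∀ i, Measurable (V i))
    (hV : ∀ i, Integrable (fun ω => V i ω ^ 4) P) (h0 : ∀ i, ∫ ω, V i ω ∂P = 0)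
    (ha : ∀ i, 0 ≤ a i) (h2 : ∀ i, ∫ ω, V i ω ^ 2 ∂P ≤ D * a i)
    (h4 : ∀ i, ∫ ω, V i ω ^ 4 ∂P ≤ M * a i ^ 2) (s : Finset ι) :
    Integrable (fun ω => (∑ i ∈ s, V i ω) ^ 4) P ∧ ∫ ω, (∑ i ∈ s, V i ω) ∂P = 0 ∧
      ∫ ω, (∑ i ∈ s, V i ω) ^ 2 ∂P ≤ D * ∑ i ∈ s, a i ∧
      ∫ ω, (∑ i ∈ s, V i ω) ^ 4 ∂P ≤ 3 * M * (∑ i ∈ s, a i) ^ 2 := by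
  classical
  induction s using Finset.induction_on with
  | empty => simp
  | insert i s hi ih =>
    obtain ⟨ih4, ihm, ihs, ihf⟩ := ih
    simp only [Finset.sum_insert hi]
    obtain ⟨S, hS⟩ : ∃ S : Ω → ℝ, ∀ ω, ∑ i ∈ s, V i ω = S ω := ⟨_, fun _ => rfl⟩
    simp only [hS] at ih4 ihm ihs ihf ⊢
    have hSm : Measurable S := by
      rw [← funext hS]
      exact Finset.measurable_sum _ fun i _ => hm i
    have hSV : IndepFun (V i) S P := by
      have h := (hind.indepFun_finsetSum_of_notMem hm hi).symm
      convert h using 1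
      ext ω
      simp [← hS]
    have hpow : ∀ k l : ℕ, IndepFun (fun ω => V i ω ^ k) (fun ω => S ω ^ l) P := fun k l =>
      hSV.comp (φ := fun x => x ^ k) (ψ := fun x => x ^ l) (by fun_prop) (by fun_prop)
    have hVi : ∀ k : ℕ, k ≤ 4 → Integrable (fun ω => V i ω ^ k) P := fun k hk =>
      integrable_pow_of_le_four (hm i).aestronglyMeasurable (hV i) hk
    have hSi : ∀ k : ℕ, k ≤ 4 → Integrable (fun ω => S ω ^ k) P := fun k hk =>
      integrable_pow_of_le_four hSm.aestronglyMeasurable ih4 hk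
    have hint : ∀ k l : ℕ, k ≤ 4 → l ≤ 4 → Integrable (fun ω => V i ω ^ k * S ω ^ l) P :=
      fun k l hk hl => (hpow k l).integrable_mul (hVi k hk) (hSi l hl)
    have hmul : ∀ k l : ℕ, ∫ ω, V i ω ^ k * S ω ^ l ∂P
        = (∫ ω, V i ω ^ k ∂P) * ∫ ω, S ω ^ l ∂P := fun k l =>
      (hpow k l).integral_fun_mul_eq_mul_integral ((hm i).pow_const k).aestronglyMeasurable
        (hSm.pow_const l).aestronglyMeasurable
    have e4 : ∀ ω, (V i ω + S ω) ^ 4 = V i ω ^ 4 + (4 * (V i ω ^ 3 * S ω ^ 1)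
        + (6 * (V i ω ^ 2 * S ω ^ 2) + (4 * (V i ω ^ 1 * S ω ^ 3) + S ω ^ 4))) := fun ω => by ring
    have e2 : ∀ ω, (V i ω + S ω) ^ 2 = V i ω ^ 2 + (2 * (V i ω ^ 1 * S ω ^ 1) + S ω ^ 2) :=
      fun ω => by ring
    have hV1 : ∫ ω, V i ω ^ 1 ∂P = 0 := by simpa using h0 i
    have hS1 : ∫ ω, S ω ^ 1 ∂P = 0 := by simpa using ihm
    have i3 : Integrable (fun ω => 4 * (V i ω ^ 1 * S ω ^ 3) + S ω ^ 4) P :=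
      ((hint 1 3 (by norm_num) (by norm_num)).const_mul 4).add (hSi 4 le_rfl)
    have i2 : Integrable (fun ω => 6 * (V i ω ^ 2 * S ω ^ 2)
        + (4 * (V i ω ^ 1 * S ω ^ 3) + S ω ^ 4)) P :=
      ((hint 2 2 (by norm_num) (by norm_num)).const_mul 6).add i3
    have i1 : Integrable (fun ω => 4 * (V i ω ^ 3 * S ω ^ 1) + (6 * (V i ω ^ 2 * S ω ^ 2)
        + (4 * (V i ω ^ 1 * S ω ^ 3) + S ω ^ 4))) P :=
      ((hint 3 1 (by norm_num) (by norm_num)).const_mul 4).add i2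
    have hA : 0 ≤ ∑ i ∈ s, a i := Finset.sum_nonneg fun i _ => ha i
    refine ⟨?_, ?_, ?_, ?_⟩
    · simp only [e4]
      exact (hV i).add i1
    · rw [integral_add (by simpa using hVi 1 (by norm_num)) (by simpa using hSi 1 (by norm_num)),
        h0, ihm, add_zero]
    · simp only [e2]
      have j1 := (hint 1 1 (by norm_num) (by norm_num)).const_mul 2
      have j2 : Integrable (fun ω => 2 * (V i ω ^ 1 * S ω ^ 1) + S ω ^ 2) P :=
        j1.add (hSi 2 (by norm_num))
      rw [integral_add (hVi 2 (by norm_num)) j2,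
        integral_add j1 (hSi 2 (by norm_num)), integral_const_mul, hmul, hV1]
      linarith [h2 i]
    · simp only [e4]
      rw [integral_add (hV i) i1, integral_add ((hint 3 1 (by norm_num) (by norm_num)).const_mul 4)
        i2, integral_add ((hint 2 2 (by norm_num) (by norm_num)).const_mul 6) i3,
        integral_add ((hint 1 3 (by norm_num) (by norm_num)).const_mul 4) (hSi 4 le_rfl),
        integral_const_mul, integral_const_mul, integral_const_mul, hmul, hmul, hmul, hV1, hS1]
      -- Centring kills the odd terms. With a = a i and A the sum over s, what remains is at most M
      -- (a² + 6aA + 3A²) ≤ 3M (a + A)²; the bound D² ≤ M absorbs the product of second moments.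
      have hV2 : 0 ≤ ∫ ω, V i ω ^ 2 ∂P := integral_nonneg fun ω => sq_nonneg _
      have h6 : (∫ ω, V i ω ^ 2 ∂P) * ∫ ω, S ω ^ 2 ∂P ≤ (D * a i) * (D * ∑ i ∈ s, a i) :=
        mul_le_mul (h2 i) ihs (integral_nonneg fun ω => sq_nonneg _) (mul_nonneg hD (ha i))
      have h7 : (D * a i) * (D * ∑ i ∈ s, a i) ≤ M * (a i * ∑ i ∈ s, a i) := by
        have := mul_le_mul_of_nonneg_right hDM (mul_nonneg (ha i) hA)
        linarith
      have hM : 0 ≤ M * a i ^ 2 := mul_nonneg ((sq_nonneg D).trans hDM) (sq_nonneg _)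
      have := h4 i
      nlinarith

theorem memLp_two_noise (hZ : RegularZ P Z δ) (i : ℕ) (j : Fin n) : MemLp (Z i j) 2 P :=
  (hZ.memLp i j).mono_exponent (by norm_num)

theorem integral_noise_mul (hZ : RegularZ P Z δ) (i : ℕ) (j k : Fin n) :
    ∫ ω, Z i j ω * Z i k ω ∂P = if j = k then δ ^ 2 else 0 := by
  split_ifs with h
  · subst h
    simpa only [sq] using integral_noise_sq hZ i j
  · have h1 := covariance_eq_sub (memLp_two_noise hZ i j) (memLp_two_noise hZ i k)
    rw [hZ.uncorrelated i j k h, hZ.mean_zero, zero_mul, sub_zero] at h1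
    exact h1.symm

theorem ae_tendsto_average_noise (hZ : RegularZ P Z δ) (j : Fin n) :
    ∀ᵐ ω ∂P, Tendsto (fun p : ℕ => (∑ i ∈ Finset.range p, Z i j ω) / p) atTop (𝓝 0) := by
  refine ae_tendsto_average_of_orthogonal (fun i => memLp_two_noise hZ i j) (fun i l hil => ?_)
    (fun i => (integral_noise_sq hZ i j).le)
  have h1 := indepFun_noise hZ hil (measurable_pi_apply j) (measurable_pi_apply j)
  rw [h1.integral_fun_mul_eq_mul_integral (hZ.measurable i j).aestronglyMeasurable
    (hZ.measurable l j).aestronglyMeasurable, hZ.mean_zero, zero_mul]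

/-- After subtracting their mean the products are centred and independent across rows. The uniform
fourth moments bound their second moments, through (xy - c)² ≤ x⁴ + y⁴ + 2c². -/
theorem ae_tendsto_average_noise_mul (hZ : RegularZ P Z δ) (j k : Fin n) :
    ∀ᵐ ω ∂P, Tendsto (fun p : ℕ => (∑ i ∈ Finset.range p, Z i j ω * Z i k ω) / p) atTop
      (𝓝 (if j = k then δ ^ 2 else 0)) := by
  set c : ℝ := if j = k then δ ^ 2 else 0
  obtain ⟨M, hM⟩ := hZ.fourth_moment
  have hm : ∀ i, Measurable fun ω => Z i j ω * Z i k ω - c := fun i =>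
    ((hZ.measurable i j).mul (hZ.measurable i k)).sub_const c
  have hI := fun i j => integrable_pow_four_of_memLp (hZ.memLp i j)
  have hdom : ∀ i, Integrable (fun ω => Z i j ω ^ 4 + Z i k ω ^ 4 + 2 * c ^ 2) P := fun i =>
    ((hI i j).add (hI i k)).add (integrable_const _)
  have hle : ∀ x y : ℝ, (x * y - c) ^ 2 ≤ x ^ 4 + y ^ 4 + 2 * c ^ 2 := fun x y => by
    nlinarith [sq_nonneg (x * y + c), sq_nonneg (x ^ 2 - y ^ 2)]
  have hsq : ∀ i, Integrable (fun ω => (Z i j ω * Z i k ω - c) ^ 2) P := fun i =>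
    (hdom i).mono' ((hm i).pow_const 2).aestronglyMeasurable (ae_of_all _ fun ω => by
      rw [Real.norm_eq_abs, abs_of_nonneg (sq_nonneg _)]
      exact hle _ _)
  have hmem : ∀ i, MemLp (fun ω => Z i j ω * Z i k ω - c) 2 P := fun i =>
    (memLp_two_iff_integrable_sq (hm i).aestronglyMeasurable).2 (hsq i)
  have hzero : ∀ i, ∫ ω, (Z i j ω * Z i k ω - c) ∂P = 0 := fun i => by
    have h : Integrable (fun ω => Z i j ω * Z i k ω) P :=
      (memLp_two_noise hZ i j).integrable_mul (memLp_two_noise hZ i k)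
    rw [integral_sub h (integrable_const c), integral_noise_mul hZ]
    simp [c]
  have h1 := ae_tendsto_average_of_orthogonal (C := M + M + 2 * c ^ 2) hmem (fun i l hil => by
      have hf : Measurable fun z : Fin n → ℝ => z j * z k - c := by fun_prop
      rw [(indepFun_noise hZ hil hf hf).integral_fun_mul_eq_mul_integral
        (hm i).aestronglyMeasurable (hm l).aestronglyMeasurable, hzero i, zero_mul])
    (fun i => by
      refine (integral_mono (hsq i) (hdom i) fun ω => hle _ _).trans ?_
      have h : Integrable (fun ω => Z i j ω ^ 4 + Z i k ω ^ 4) P := (hI i j).add (hI i k)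
      rw [integral_add h (integrable_const _), integral_add (hI i j) (hI i k)]
      simp only [integral_const, probReal_univ, one_smul]
      linarith [hM i j, hM i k])
  filter_upwards [h1] with ω hω
  have h2 := hω.add_const c
  rw [zero_add] at h2
  refine h2.congr' ?_
  filter_upwards [eventually_ge_atTop 1] with p hp
  have hp0 : (p : ℝ) ≠ 0 := by positivity
  rw [Finset.sum_sub_distrib, Finset.sum_const, Finset.card_range, nsmul_eq_mul]
  field_simp
  ring

/-- Orthogonality comes from the noise: independence of β and Z separates E[β_i β_l] from E[Z_ij
Z_lj], and the latter is 0 for i ≠ l. -/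
theorem ae_tendsto_average_beta_noise (hβ : RegularBeta P β) (hZ : RegularZ P Z δ)
    (hind : JointlyIndependent P β X Z) (j : Fin n) :
    ∀ᵐ ω ∂P, Tendsto (fun p : ℕ => (∑ i ∈ Finset.range p, β i ω * Z i j ω) / p) atTop (𝓝 0) := by
  obtain ⟨C, hC⟩ := hβ.bounded
  have hβZ : IndepFun (fun ω i => β i ω) (fun ω i j => Z i j ω) P := by
    rw [IndepFun_iff_Indep]
    exact iIndep.indep hind (i := 0) (j := 2) (by decide)
  have hm : ∀ i, AEStronglyMeasurable (fun ω => β i ω * Z i j ω) P := fun i =>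
    ((hβ.measurable i).mul (hZ.measurable i j)).aestronglyMeasurable
  have hmem : ∀ i, MemLp (fun ω => β i ω * Z i j ω) 2 P := fun i => by
    refine (memLp_two_noise hZ i j).of_le_mul (c := C) (hm i) ?_
    filter_upwards [hC i] with ω hω
    rw [norm_mul]
    exact mul_le_mul_of_nonneg_right hω (norm_nonneg _)
  refine ae_tendsto_average_of_orthogonal (C := C ^ 2 * δ ^ 2) hmem (fun i l hil => ?_)
    (fun i => ?_)
  · have h1 : IndepFun (fun ω => β i ω * β l ω) (fun ω => Z i j ω * Z l j ω) P :=
      hβZ.comp (φ := fun b : ℕ → ℝ => b i * b l)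
        (ψ := fun z : ℕ → Fin n → ℝ => z i j * z l j) (by fun_prop) (by fun_prop)
    have h2 := indepFun_noise hZ hil (measurable_pi_apply j) (measurable_pi_apply j)
    have h3 : ∀ ω, β i ω * Z i j ω * (β l ω * Z l j ω) = β i ω * β l ω * (Z i j ω * Z l j ω) :=
      fun ω => by ring
    simp only [h3]
    rw [h1.integral_fun_mul_eq_mul_integral
      ((hβ.measurable i).mul (hβ.measurable l)).aestronglyMeasurable
      ((hZ.measurable i j).mul (hZ.measurable l j)).aestronglyMeasurable,
      h2.integral_fun_mul_eq_mul_integral (hZ.measurable i j).aestronglyMeasurable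
      (hZ.measurable l j).aestronglyMeasurable, hZ.mean_zero, zero_mul, mul_zero]
  · rw [← integral_noise_sq hZ i j, ← integral_const_mul]
    refine integral_mono_ae (hmem i).integrable_sq
      ((memLp_two_noise hZ i j).integrable_sq.const_mul _) ?_
    filter_upwards [hC i] with ω hω
    rw [mul_pow]
    exact mul_le_mul_of_nonneg_right (sq_le_sq.2 (hω.trans (le_abs_self C))) (sq_nonneg _)

theorem tendsto_average_sq {b : ℕ → ℝ} {μ d : ℝ} (hμ : μ ≠ 0)
    (hm : Tendsto (fun p => mean b p) atTop (𝓝 μ))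
    (hd : Tendsto (fun p => dispersion b p) atTop (𝓝 d)) :
    Tendsto (fun p : ℕ => (∑ i ∈ Finset.range p, b i ^ 2) / p) atTop
      (𝓝 (μ ^ 2 * (d ^ 2 + 1))) := by
  refine ((hm.pow 2).mul ((hd.pow 2).add_const 1)).congr' ?_
  filter_upwards [eventually_ge_atTop 1, hm.eventually_ne hμ] with p hp hne
  have hp0 : (p : ℝ) ≠ 0 := by positivity
  have hs : ∑ i ∈ Finset.range p, b i = p * mean b p := by
    rw [mean]; field_simp
  have h1 : ∑ i ∈ Finset.range p, ((b i - mean b p) / mean b p) ^ 2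
      = ((∑ i ∈ Finset.range p, b i ^ 2) - p * mean b p ^ 2) / mean b p ^ 2 := by
    have h2 : ∀ i, ((b i - mean b p) / mean b p) ^ 2
        = (b i ^ 2 - 2 * mean b p * b i + mean b p ^ 2) / mean b p ^ 2 := fun i => by
      rw [div_pow]; ring
    simp only [h2]
    rw [← Finset.sum_div, Finset.sum_add_distrib, Finset.sum_sub_distrib, ← Finset.mul_sum, hs,
      Finset.sum_const, Finset.card_range, nsmul_eq_mul]
    ring
  rw [dispersion, Real.sq_sqrt (div_nonneg (Finset.sum_nonneg fun _ _ => sq_nonneg _)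
    (Nat.cast_nonneg p)), h1]
  field_simp
  ring

theorem ae_limitLaws (hβ : RegularBeta P β) (hZ : RegularZ P Z δ)
    (hind : JointlyIndependent P β X Z) :
    ∀ᵐ ω ∂P, ∃ B μ : ℝ, LimitLaws (fun i => β i ω) (fun i j => Z i j ω) δ B μ := by
  filter_upwards [hβ.limits, ae_all_iff.2 fun j => ae_tendsto_average_noise hZ j,
    ae_all_iff.2 fun j => ae_all_iff.2 fun k => ae_tendsto_average_noise_mul hZ j k,
    ae_all_iff.2 fun j => ae_tendsto_average_beta_noise hβ hZ hind j] with ω hω h1 h2 h3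
  obtain ⟨μ, d, hμ, hd, hmean, hdisp⟩ := hω
  -- The mean of β² is the squared mean times one plus the squared dispersion, whence B = μ²(d² +
  -- 1).
  refine ⟨μ ^ 2 * (d ^ 2 + 1), μ, by positivity, hμ, ?_, ?_, fun j k => ?_, fun j => ?_,
    fun j => ?_⟩
  · refine (tendsto_average_sq hμ.ne' hmean hdisp).congr fun p => ?_
    rw [norm_sq_eq_sum, ← Fin.sum_univ_eq_sum_range (fun i => β i ω ^ 2)]
    rfl
  · refine hmean.congr fun p => ?_
    rw [inner_eq_sum, mean, ← Fin.sum_univ_eq_sum_range (fun i => β i ω)]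
    simp only [betaVec, qVec, ← Finset.sum_mul]
    rw [div_eq_mul_inv, div_eq_mul_inv, mul_assoc, ← mul_inv,
      Real.mul_self_sqrt (Nat.cast_nonneg p)]
  · refine (h2 j k).congr fun p => ?_
    rw [inner_eq_sum, ← Fin.sum_univ_eq_sum_range (fun i => Z i j ω * Z i k ω)]
    rfl
  · refine (h3 j).congr fun p => ?_
    rw [inner_eq_sum, ← Fin.sum_univ_eq_sum_range (fun i => β i ω * Z i j ω)]
    rfl
  · refine (h1 j).congr fun p => ?_
    rw [inner_eq_sum, ← Fin.sum_univ_eq_sum_range (fun i => Z i j ω)]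
    simp only [noiseVec, qVec, ← Finset.sum_mul]
    rw [div_eq_mul_inv, div_eq_mul_inv, mul_assoc, ← mul_inv,
      Real.mul_self_sqrt (Nat.cast_nonneg p)]

end

/-! ### Fourth moments and the projection of the noise -/

section

variable {Ω : Type*} [MeasurableSpace Ω] {P : Measure Ω}

/-- Tonelli on the product law: a bound uniform over frozen values of f survives averaging over f.
It lets random directions be treated as fixed ones. -/
theorem lintegral_le_of_indepFun [IsProbabilityMeasure P] {S T : Type*} [MeasurableSpace S]
    [MeasurableSpace T] {f : Ω → S} {g : Ω → T} (hf : Measurable f) (hg : Measurable g)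
    (hfg : IndepFun f g P) {F : S → T → ENNReal} (hF : Measurable (Function.uncurry F))
    {c : ENNReal} (hc : ∀ s, ∫⁻ ω, F s (g ω) ∂P ≤ c) : ∫⁻ ω, F (f ω) (g ω) ∂P ≤ c := by
  have h1 := (indepFun_iff_map_prod_eq_prod_map_map hf.aemeasurable hg.aemeasurable).1 hfg
  have : IsProbabilityMeasure (P.map f) := Measure.isProbabilityMeasure_map hf.aemeasurable
  have : IsProbabilityMeasure (P.map g) := Measure.isProbabilityMeasure_map hg.aemeasurable
  calc ∫⁻ ω, F (f ω) (g ω) ∂P = ∫⁻ x, Function.uncurry F x ∂(P.map fun ω => (f ω, g ω)) :=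
        (lintegral_map hF (hf.prodMk hg)).symm
    _ = ∫⁻ s, ∫⁻ t, F s t ∂(P.map g) ∂(P.map f) := by
        rw [h1, lintegral_prod _ hF.aemeasurable]; rfl
    _ ≤ ∫⁻ _s, c ∂(P.map f) := by
        refine lintegral_mono fun s => ?_
        have h2 : Measurable (F s) := hF.comp (measurable_prodMk_left (x := s))
        rw [lintegral_map h2 hg]
        exact hc s
    _ = c := by simp

theorem tendsto_zero_of_pow_four {u : ℕ → ℝ} (h : Tendsto (fun p => u p ^ 4) atTop (𝓝 0)) :
    Tendsto u atTop (𝓝 0) := by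
  have h1 := h.sqrt.sqrt
  rw [Real.sqrt_zero, Real.sqrt_zero] at h1
  refine tendsto_zero_iff_abs_tendsto_zero _ |>.2 (h1.congr fun p => ?_)
  rw [show u p ^ 4 = (u p ^ 2) ^ 2 by ring, Real.sqrt_sq (sq_nonneg _), Real.sqrt_sq_eq_abs]
  rfl

theorem ae_tendsto_zero_of_fourth_moment {x : ℕ → Ω → ℝ} {D : ℝ} (hD : 0 ≤ D)
    (hx : ∀ p, Measurable (x p))
    (h : ∀ p, 1 ≤ p → ∫⁻ ω, ENNReal.ofReal (x p ω ^ 4) ∂P ≤ ENNReal.ofReal (D / (p : ℝ) ^ 2)) :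
    ∀ᵐ ω ∂P, Tendsto (fun p => x p ω) atTop (𝓝 0) := by
  -- The moment bound is assumed only for p ≥ 1, so the term at p = 0 is overwritten by 0.
  have hae := ae_tendsto_zero_of_summable (P := P) (f := fun p ω => if p = 0 then 0 else x p ω ^ 4)
    (a := fun p : ℕ => D * (1 / (p : ℝ) ^ 2)) (fun p => ?_) (fun p ω => ?_) (fun p => by positivity)
    ((Real.summable_one_div_nat_pow.2 one_lt_two).mul_left D) (fun p => ?_)
  · filter_upwards [hae] with ω hω
    refine tendsto_zero_of_pow_four (hω.congr' ?_)
    filter_upwards [eventually_ge_atTop 1] with p hp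
    rw [if_neg (by omega)]
  · split_ifs
    · exact aemeasurable_const
    · exact ((hx p).pow_const 4).aemeasurable
  · split_ifs <;> positivity
  · split_ifs with h0
    · simp
    · refine (h p (by omega)).trans_eq ?_
      rw [mul_one_div]

theorem lintegral_div_sqrt_pow_four_le {f : Ω → ℝ} {D : ℝ} (p : ℕ)
    (hf : ∫⁻ ω, ENNReal.ofReal (f ω ^ 4) ∂P ≤ ENNReal.ofReal D) :
    ∫⁻ ω, ENNReal.ofReal ((f ω / √p) ^ 4) ∂P ≤ ENNReal.ofReal (D / (p : ℝ) ^ 2) := by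
  have h2 : √(p : ℝ) ^ 4 = (p : ℝ) ^ 2 := by
    rw [show √(p : ℝ) ^ 4 = (√(p : ℝ) ^ 2) ^ 2 by ring, Real.sq_sqrt (Nat.cast_nonneg p)]
  have h3 : ∀ x : ℝ, (x / √p) ^ 4 = ((p : ℝ) ^ 2)⁻¹ * x ^ 4 := fun x => by
    rw [div_pow, h2]; ring
  have hp : (0 : ℝ) ≤ ((p : ℝ) ^ 2)⁻¹ := by positivity
  simp only [h3, ENNReal.ofReal_mul hp]
  rw [lintegral_const_mul' _ _ ENNReal.ofReal_ne_top, div_eq_inv_mul, ENNReal.ofReal_mul hp]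
  gcongr

/-- Sums of squares of `k p` random variables with fourth moments of order `p⁻²`. -/
theorem ae_tendsto_sum_sq_of_fourth_moment {k : ℕ → ℕ} (hk : SquareRootDominated k)
    {x : (p : ℕ) → Fin p → Ω → ℝ} {D : ℝ} (hD : 0 ≤ D) (hx : ∀ p i, Measurable (x p i))
    (h : ∀ p i, ∫⁻ ω, ENNReal.ofReal (x p i ω ^ 4) ∂P ≤ ENNReal.ofReal (D / (p : ℝ) ^ 2)) :
    ∀ᵐ ω ∂P, Tendsto (fun p => ∑ i ∈ Finset.univ.filter (fun i : Fin p => (i : ℕ) < k p),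
      x p i ω ^ 2) atTop (𝓝 0) := by
  have hcard : ∀ p, (Finset.univ.filter (fun i : Fin p => (i : ℕ) < k p)).card ≤ k p := fun p => by
    have h1 : ((Finset.univ.filter (fun i : Fin p => (i : ℕ) < k p)).map Fin.valEmbedding)
        ⊆ Finset.range (k p) := by
      intro i hi
      obtain ⟨j, hj, rfl⟩ := Finset.mem_map.1 hi
      simpa using hj
    simpa using Finset.card_le_card h1
  -- By Cauchy–Schwarz (∑ x²)² ≤ k ∑ x⁴, whose expectation is at most D k²/p²: exactly the series in
  -- `SquareRootDominated`.
  have hae := ae_tendsto_zero_of_summable (P := P)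
    (f := fun p ω => k p * ∑ i ∈ Finset.univ.filter (fun i : Fin p => (i : ℕ) < k p), x p i ω ^ 4)
    (a := fun p : ℕ => D * ((k p : ℝ) ^ 2 / (p : ℝ) ^ 2))
    (fun p => ((Finset.measurable_sum _ fun i _ => (hx p i).pow_const 4).const_mul _).aemeasurable)
    (fun p ω => mul_nonneg (Nat.cast_nonneg _) (Finset.sum_nonneg fun i _ => by positivity))
    (fun p => by positivity) (hk.summable.mul_left D) (fun p => ?_)
  · filter_upwards [hae] with ω hω
    have h1 := hω.sqrt
    rw [Real.sqrt_zero] at h1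
    refine squeeze_zero (fun p => Finset.sum_nonneg fun i _ => sq_nonneg _) (fun p => ?_) h1
    refine Real.le_sqrt_of_sq_le ?_
    refine (sq_sum_le_card_mul_sum_sq).trans ?_
    have h2 : ∀ i, (x p i ω ^ 2) ^ 2 = x p i ω ^ 4 := fun i => by ring
    simp only [h2]
    refine mul_le_mul_of_nonneg_right (by exact_mod_cast hcard p)
      (Finset.sum_nonneg fun i _ => by positivity)
  · have hp : ∀ i : Fin p, ∀ ω, 0 ≤ x p i ω ^ 4 := fun i ω => by positivity
    calc _ = ENNReal.ofReal (k p) * ∑ i ∈ Finset.univ.filter (fun i : Fin p => (i : ℕ) < k p),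
          ∫⁻ ω, ENNReal.ofReal (x p i ω ^ 4) ∂P := by
          rw [← lintegral_finsetSum _ fun i _ => ((hx p i).pow_const 4).ennreal_ofReal,
            ← lintegral_const_mul _ (Finset.measurable_sum _ fun i _ =>
              ((hx p i).pow_const 4).ennreal_ofReal)]
          refine lintegral_congr fun ω => ?_
          rw [ENNReal.ofReal_mul (Nat.cast_nonneg _),
            ENNReal.ofReal_sum_of_nonneg fun i _ => hp i ω]
      _ ≤ ENNReal.ofReal (k p) * ∑ _i ∈ Finset.univ.filter (fun i : Fin p => (i : ℕ) < k p),
          ENNReal.ofReal (D / (p : ℝ) ^ 2) := by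
          gcongr with i _
          exact h p i
      _ ≤ ENNReal.ofReal (k p) * (ENNReal.ofReal (k p) * ENNReal.ofReal (D / (p : ℝ) ^ 2)) := by
          rw [Finset.sum_const, nsmul_eq_mul, ENNReal.ofReal_natCast]
          gcongr
          exact hcard p
      _ = ENNReal.ofReal (D * ((k p : ℝ) ^ 2 / (p : ℝ) ^ 2)) := by
          rw [← ENNReal.ofReal_mul (Nat.cast_nonneg _), ← ENNReal.ofReal_mul (Nat.cast_nonneg _)]
          congr 1
          ring

variable {n : ℕ} {Z : ℕ → Fin n → Ω → ℝ} {δ : ℝ} {β : ℕ → Ω → ℝ}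

theorem measurable_noiseVec (hZ : RegularZ P Z δ) (j : Fin n) (p : ℕ) :
    Measurable fun ω => noiseVec (fun i j => Z i j ω) j p := by
  have h : Measurable fun ω (i : Fin p) => Z i j ω :=
    measurable_pi_lambda _ fun i => hZ.measurable i j
  exact (WithLp.measurable_toLp 2 (Fin p → ℝ)).comp h

variable [IsProbabilityMeasure P]

/-- `integral_sum_pow_four_le` with weights u_i², which sum to at most 1, gives a constant
independent of p, j and u. The uniformity in u is what permits a random u independent of Z. -/
theorem exists_lintegral_inner_noise_pow_four_le (hZ : RegularZ P Z δ) :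
    ∃ D : ℝ, 0 ≤ D ∧ ∀ (p : ℕ) (j : Fin n) (u : EuclideanSpace ℝ (Fin p)), ‖u‖ ≤ 1 →
      ∫⁻ ω, ENNReal.ofReal ((inner ℝ u (noiseVec (fun i j => Z i j ω) j p)) ^ 4) ∂P
        ≤ ENNReal.ofReal D := by
  obtain ⟨M₀, hM₀⟩ := hZ.fourth_moment
  set M := max M₀ ((δ ^ 2) ^ 2)
  have hM : 0 ≤ M := le_max_of_le_right (sq_nonneg _)
  refine ⟨3 * M, by positivity, fun p j u hu => ?_⟩
  have hrow : iIndepFun (fun (i : Fin p) ω => u i * Z i j ω) P :=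
    (hZ.rows_indep.precomp Fin.val_injective).comp (fun (i : Fin p) (z : Fin n → ℝ) => u i * z j)
      (fun i => by fun_prop)
  have hint : ∀ i : Fin p, Integrable (fun ω => (u i * Z i j ω) ^ 4) P := fun i => by
    simp only [mul_pow]
    exact (integrable_pow_four_of_memLp (hZ.memLp i j)).const_mul _
  obtain ⟨h1, -, -, h4⟩ := integral_sum_pow_four_le (a := fun i => u i ^ 2) (D := δ ^ 2) (M := M)
    (sq_nonneg _) (le_max_right _ _) hrow (fun i => (hZ.measurable i j).const_mul _) hint
    (fun i => by rw [integral_const_mul, hZ.mean_zero, mul_zero]) (fun i => sq_nonneg _)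
    (fun i => by
      simp only [mul_pow]
      rw [integral_const_mul, integral_noise_sq hZ, mul_comm])
    (fun i => by
      simp only [mul_pow]
      rw [integral_const_mul, ← pow_mul, mul_comm]
      exact mul_le_mul_of_nonneg_right ((hM₀ i j).trans (le_max_left _ _)) (by positivity))
    Finset.univ
  have h2 : ∀ ω, inner ℝ u (noiseVec (fun i j => Z i j ω) j p) = ∑ i, u i * Z i j ω := fun ω => by
    rw [inner_eq_sum]; rfl
  simp only [h2]
  rw [← ofReal_integral_eq_lintegral_ofReal h1 (ae_of_all _ fun ω => by positivity)]
  refine ENNReal.ofReal_le_ofReal (h4.trans ?_)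
  rw [← norm_sq_eq_sum]
  refine mul_le_of_le_one_right (by positivity) (pow_le_one₀ (sq_nonneg _)
    (pow_le_one₀ (norm_nonneg _) hu))

theorem measurable_frame {p : ℕ} (i : Fin p) :
    Measurable fun g : Matrix.orthogonalGroup (Fin p) ℝ => frame g i := by
  have h : Continuous fun g : Matrix.orthogonalGroup (Fin p) ℝ => frame g i := by
    refine (PiLp.continuous_toLp 2 _).comp (continuous_pi fun l => ?_)
    exact (continuous_apply_apply l i).comp continuous_subtype_val
  exact h.measurable

theorem measurable_unitResidual {p : ℕ} (k : ℕ) (q : EuclideanSpace ℝ (Fin p)) :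
    Measurable fun g : Matrix.orthogonalGroup (Fin p) ℝ => unitResidual (subspaceOf g k) q := by
  have h : Measurable fun g : Matrix.orthogonalGroup (Fin p) ℝ =>
      q - (subspaceOf g k).starProjection q := by
    simp only [starProjection_subspaceOf]
    refine measurable_const.sub (Finset.measurable_sum _ fun i _ => ?_)
    exact (Measurable.inner (𝕜 := ℝ) (measurable_frame i) measurable_const).smul (measurable_frame i)
  exact h.norm.inv.smul h

theorem lintegral_inner_noise_pow_four_le {p : ℕ} {ξ : Ω → Matrix.orthogonalGroup (Fin p) ℝ}
    (hZ : RegularZ P Z δ) (hξ : Measurable ξ) (hind : IndependentOfBetaZ P β Z ξ) {D : ℝ}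
    {j : Fin n} (hD : ∀ u : EuclideanSpace ℝ (Fin p), ‖u‖ ≤ 1 →
      ∫⁻ ω, ENNReal.ofReal ((inner ℝ u (noiseVec (fun i j => Z i j ω) j p)) ^ 4) ∂P
        ≤ ENNReal.ofReal D)
    {u : Matrix.orthogonalGroup (Fin p) ℝ → EuclideanSpace ℝ (Fin p)} (hu : Measurable u)
    (hu1 : ∀ g, ‖u g‖ ≤ 1) :
    ∫⁻ ω, ENNReal.ofReal ((inner ℝ (u (ξ ω)) (noiseVec (fun i j => Z i j ω) j p)) ^ 4) ∂P
      ≤ ENNReal.ofReal D := by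
  have hm : Measurable fun z : Fin p → Fin n → ℝ => WithLp.toLp 2 fun i => z i j :=
    (WithLp.measurable_toLp 2 (Fin p → ℝ)).comp (by fun_prop)
  exact lintegral_le_of_indepFun (g := fun ω (i : Fin p) (j : Fin n) => Z i j ω) (F := fun g (z : Fin p → Fin n → ℝ) =>
      ENNReal.ofReal ((inner ℝ (u g) (WithLp.toLp 2 fun i => z i j)) ^ 4)) hξ
    (measurable_pi_lambda _ fun i => measurable_pi_lambda _ fun l => hZ.measurable i l) hind.noise
    (((hu.comp measurable_fst).inner (hm.comp measurable_snd)).pow_const 4).ennreal_ofReal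
    fun g => hD (u g) (hu1 g)

theorem norm_starProjection_sup_qSpan_div_sqrt {p : ℕ} (g : Matrix.orthogonalGroup (Fin p) ℝ)
    (k : ℕ) (v : EuclideanSpace ℝ (Fin p)) :
    ‖(subspaceOf g k ⊔ qSpan p).starProjection v‖ / √p
      = √((∑ i ∈ Finset.univ.filter (fun i : Fin p => (i : ℕ) < k),
          (inner ℝ (frame g i) v / √p) ^ 2)
        + (inner ℝ (unitResidual (subspaceOf g k) (qVec p)) v / √p) ^ 2) := by
  rw [qSpan, ← Real.sqrt_sq (norm_nonneg (Submodule.starProjection _ _)),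
    norm_sq_starProjection_sup_span, norm_sq_starProjection_subspaceOf,
    ← Real.sqrt_div (add_nonneg (Finset.sum_nonneg fun i _ => sq_nonneg _) (sq_nonneg _))]
  congr 1
  simp only [div_pow, Real.sq_sqrt (Nat.cast_nonneg p), add_div, Finset.sum_div]

/-- The squared projection is a sum over k p frame directions plus one residual direction for q. All
these directions are functions of ξ, hence independent of Z; square root domination handles the
frame, and ∑ p⁻² < ∞ the residual. -/
theorem ae_tendsto_starProjection_noise (hZ : RegularZ P Z δ) {k : ℕ → ℕ}
    (hk : SquareRootDominated k) {ξ : (p : ℕ) → Ω → Matrix.orthogonalGroup (Fin p) ℝ}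
    (hξ : ∀ p, Measurable (ξ p)) (hind : ∀ p, IndependentOfBetaZ P β Z (ξ p)) (j : Fin n) :
    ∀ᵐ ω ∂P, Tendsto (fun p => ‖(subspaceOf (ξ p ω) (k p) ⊔ qSpan p).starProjection
      (noiseVec (fun i j => Z i j ω) j p)‖ / √p) atTop (𝓝 0) := by
  obtain ⟨D, hD0, hD⟩ := exists_lintegral_inner_noise_pow_four_le hZ
  have hscale : ∀ (p : ℕ) {u : Matrix.orthogonalGroup (Fin p) ℝ → EuclideanSpace ℝ (Fin p)},
      Measurable u → (∀ g, ‖u g‖ ≤ 1) →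
      ∫⁻ ω, ENNReal.ofReal ((inner ℝ (u (ξ p ω)) (noiseVec (fun i j => Z i j ω) j p) / √p) ^ 4) ∂P
        ≤ ENNReal.ofReal (D / (p : ℝ) ^ 2) := fun p u hu hu1 =>
    lintegral_div_sqrt_pow_four_le p
      (lintegral_inner_noise_pow_four_le hZ (hξ p) (hind p) (hD p j) hu hu1)
  have hmeas : ∀ (p : ℕ) {u : Matrix.orthogonalGroup (Fin p) ℝ → EuclideanSpace ℝ (Fin p)},
      Measurable u → Measurable fun ω => inner ℝ (u (ξ p ω))
        (noiseVec (fun i j => Z i j ω) j p) / √p := fun p u hu =>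
    ((hu.comp (hξ p)).inner (measurable_noiseVec hZ j p)).div_const _
  have h1 := ae_tendsto_sum_sq_of_fourth_moment (P := P) hk hD0
    (x := fun p i ω => inner ℝ (frame (ξ p ω) i) (noiseVec (fun i j => Z i j ω) j p) / √p)
    (fun p i => hmeas p (u := fun g => frame g i) (measurable_frame i))
    (fun p i => hscale p (u := fun g => frame g i) (measurable_frame i) fun g => (norm_frame g i).le)
  have h2 := ae_tendsto_zero_of_fourth_moment (P := P) hD0
    (x := fun p ω => inner ℝ (unitResidual (subspaceOf (ξ p ω) (k p)) (qVec p))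
      (noiseVec (fun i j => Z i j ω) j p) / √p)
    (fun p => hmeas p (u := fun g => unitResidual (subspaceOf g (k p)) (qVec p))
      (measurable_unitResidual (k p) (qVec p)))
    (fun p _ => hscale p (u := fun g => unitResidual (subspaceOf g (k p)) (qVec p))
      (measurable_unitResidual (k p) (qVec p)) fun g => norm_unitResidual_le _ _)
  filter_upwards [h1, h2] with ω hω1 hω2
  have h3 := (hω1.add (hω2.pow 2)).sqrt
  simp only [ne_eq, OfNat.ofNat_ne_zero, not_false_eq_true, zero_pow, add_zero, Real.sqrt_zero]
    at h3
  exact h3.congr fun p => (norm_starProjection_sup_qSpan_div_sqrt (ξ p ω) (k p) _).symm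

end

/-! ### Haar frames -/

open Matrix in
/-- The orthogonal group acts transitively on unit vectors: a Householder reflection. -/
theorem exists_orthogonal_mulVec_eq {p : ℕ} {u v : Fin p → ℝ} (h : u ⬝ᵥ u = v ⬝ᵥ v) :
    ∃ g : Matrix.orthogonalGroup (Fin p) ℝ, (g : Matrix (Fin p) (Fin p) ℝ)ᵀ *ᵥ u = v := by
  by_cases h0 : u = v
  · exact ⟨1, by simp [h0]⟩
  set w := u - v
  have hw : w ⬝ᵥ w ≠ 0 := fun h1 => h0 (sub_eq_zero.1 (dotProduct_self_eq_zero.1 h1))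
  set A : Matrix (Fin p) (Fin p) ℝ := 1 - (2 / (w ⬝ᵥ w)) • vecMulVec w w
  have hAt : Aᵀ = A := by
    simp only [A, transpose_sub, transpose_one, transpose_smul, transpose_vecMulVec]
  have hAA : A * A = 1 := by
    have h2 : vecMulVec w w * vecMulVec w w = (w ⬝ᵥ w) • vecMulVec w w := by
      rw [vecMulVec_mul_vecMulVec]
      ext i j
      simp [vecMulVec_apply]
      ring
    simp only [A]
    rw [sub_mul, mul_sub, mul_sub, one_mul, mul_one, one_mul, smul_mul_smul_comm, h2, smul_smul]
    have h3 : 2 / (w ⬝ᵥ w) * (2 / (w ⬝ᵥ w)) * (w ⬝ᵥ w) = 2 / (w ⬝ᵥ w) + 2 / (w ⬝ᵥ w) := by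
      field_simp; norm_num
    rw [h3, add_smul]
    abel
  refine ⟨⟨A, (Matrix.mem_orthogonalGroup_iff _ _).2 (by rw [hAt, hAA])⟩, ?_⟩
  simp only
  rw [hAt]
  simp only [A]
  rw [sub_mulVec, one_mulVec, smul_mulVec, vecMulVec_mulVec]
  have h4 : w ⬝ᵥ w = 2 * (w ⬝ᵥ u) := by
    simp only [w, sub_dotProduct, dotProduct_sub, dotProduct_comm v u]
    linarith
  have h5 : 2 / (w ⬝ᵥ w) * (w ⬝ᵥ u) = 1 := by
    rw [div_mul_eq_mul_div, ← h4, div_self hw]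
  ext i
  have h6 : 2 / (w ⬝ᵥ w) * (w i * (w ⬝ᵥ u)) = w i := by linear_combination (w i) * h5
  simp [w] at h6 ⊢
  linarith

/-- Moves a left translation of the frame onto the test vector, so that left invariance of the
measure becomes rotation invariance in u. -/
theorem inner_frame_mul {p : ℕ} (g₀ g : Matrix.orthogonalGroup (Fin p) ℝ) (i : Fin p)
    (u : EuclideanSpace ℝ (Fin p)) :
    inner ℝ (frame (g₀ * g) i) u = inner ℝ (frame g i)
      (WithLp.toLp 2 ((g₀ : Matrix (Fin p) (Fin p) ℝ).transpose.mulVec u)) := by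
  simp only [inner_eq_sum, frame, Submonoid.coe_mul, Matrix.mul_apply, Matrix.mulVec, dotProduct,
    Matrix.transpose_apply, Finset.sum_mul, Finset.mul_sum]
  rw [Finset.sum_comm]
  exact Finset.sum_congr rfl fun l _ => Finset.sum_congr rfl fun m _ => by ring

section

variable {p : ℕ} (μ : Measure (Matrix.orthogonalGroup (Fin p) ℝ))

theorem integral_inner_frame_pow_eq [μ.IsMulLeftInvariant] (i : Fin p) {u v : EuclideanSpace ℝ (Fin p)}
    (h : ‖u‖ = ‖v‖) (k : ℕ) :
    ∫ g, (inner ℝ (frame g i) u) ^ k ∂μ = ∫ g, (inner ℝ (frame g i) v) ^ k ∂μ := by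
  have h1 : (u : Fin p → ℝ) ⬝ᵥ u = (v : Fin p → ℝ) ⬝ᵥ v := by
    have h2 : ‖u‖ ^ 2 = ‖v‖ ^ 2 := by rw [h]
    rw [norm_sq_eq_sum, norm_sq_eq_sum] at h2
    simpa only [dotProduct, sq] using h2
  obtain ⟨g₀, hg₀⟩ := exists_orthogonal_mulVec_eq h1
  rw [← integral_mul_left_eq_self (fun g => (inner ℝ (frame g i) u) ^ k) g₀]
  simp only [inner_frame_mul, hg₀]

variable [IsProbabilityMeasure μ]

theorem integrable_of_frame {f : EuclideanSpace ℝ (Fin p) → ℝ} (hf : Continuous f) (i : Fin p) :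
    Integrable (fun g => f (frame g i)) μ := by
  obtain ⟨C, hC⟩ := (isCompact_closedBall (0 : EuclideanSpace ℝ (Fin p)) 1).exists_bound_of_continuousOn
    hf.continuousOn
  refine Integrable.of_bound (hf.measurable.comp (measurable_frame i)).aestronglyMeasurable C
    (ae_of_all _ fun g => hC _ ?_)
  rw [mem_closedBall_zero_iff, norm_frame]

/-- The fourth moment of a coordinate of a uniformly distributed unit vector. -/
theorem integral_inner_frame_pow_four_le [μ.IsMulLeftInvariant] (i : Fin p) {v : EuclideanSpace ℝ (Fin p)}
    (hv : ‖v‖ = 1) : ∫ g, (inner ℝ (frame g i) v) ^ 4 ∂μ ≤ 3 / (p : ℝ) ^ 2 := by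
  set m := ∫ g, (inner ℝ (frame g i) v) ^ 4 ∂μ
  have hm0 : 0 ≤ m := integral_nonneg fun g => by positivity
  have hint : ∀ l k, Integrable (fun g => (frame g i l) ^ 2 * (frame g i k) ^ 2) μ := fun l k =>
    integrable_of_frame μ (f := fun x => x l ^ 2 * x k ^ 2) (by fun_prop) i
  have hint4 : ∀ l, Integrable (fun g => (frame g i l) ^ 4) μ := fun l =>
    integrable_of_frame μ (f := fun x => x l ^ 4) (by fun_prop) i
  have hcoord : ∀ l, ∫ g, (frame g i l) ^ 4 ∂μ = m := fun l => by
    have h1 := integral_inner_frame_pow_eq μ i (u := EuclideanSpace.single l 1) (v := v)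
      (by simp [hv]) 4
    refine Eq.trans ?_ h1
    simp [EuclideanSpace.inner_single_right]
  -- The vectors e_l ± e_k have norm √2, so by rotation invariance E(x_l ± x_k)⁴ = 4m. Adding both
  -- signs gives 8m = 4m + 12 E(x_l² x_k²).
  have hmixed : ∀ l k, l ≠ k → ∫ g, (frame g i l) ^ 2 * (frame g i k) ^ 2 ∂μ = m / 3 := by
    intro l k hlk
    have hpm : ∀ s : ℝ, s ^ 2 = 1 → ∫ g, (frame g i l + s * frame g i k) ^ 4 ∂μ = 4 * m := by
      intro s hs
      have hnorm : ‖EuclideanSpace.single l (1 : ℝ) + EuclideanSpace.single k s‖ = ‖√2 • v‖ := by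
        rw [norm_smul, hv, mul_one, Real.norm_eq_abs, abs_of_nonneg (Real.sqrt_nonneg _)]
        rw [← Real.sqrt_sq (norm_nonneg _), norm_add_sq_real]
        congr 1
        have hss : |s| ^ 2 = 1 := by rw [sq_abs, hs]
        simp [EuclideanSpace.inner_single_right, hss, Ne.symm hlk]
        norm_num
      have h1 := integral_inner_frame_pow_eq μ i hnorm 4
      have h2 : ∀ g, inner ℝ (frame g i) (√2 • v) ^ 4 = 4 * inner ℝ (frame g i) v ^ 4 := fun g => by
        rw [inner_smul_right, mul_pow, show √(2 : ℝ) ^ 4 = (√2 ^ 2) ^ 2 by ring,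
          Real.sq_sqrt zero_le_two]
        norm_num
      simp only [h2] at h1
      rw [integral_const_mul] at h1
      rw [← h1]
      simp [inner_add_right, EuclideanSpace.inner_single_right]
    have hp := hpm 1 (by norm_num)
    have hn := hpm (-1) (by norm_num)
    have hi : ∀ s : ℝ, Integrable (fun g => (frame g i l + s * frame g i k) ^ 4) μ := fun s =>
      integrable_of_frame μ (f := fun x => (x l + s * x k) ^ 4) (by fun_prop) i
    have hsum : ∫ g, ((frame g i l + 1 * frame g i k) ^ 4
        + (frame g i l + (-1) * frame g i k) ^ 4) ∂μ = 8 * m := by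
      rw [integral_add (hi 1) (hi (-1)), hp, hn]; ring
    have hexp : ∀ g : Matrix.orthogonalGroup (Fin p) ℝ, (frame g i l + 1 * frame g i k) ^ 4
        + (frame g i l + (-1) * frame g i k) ^ 4
        = (2 * (frame g i l) ^ 4 + 2 * (frame g i k) ^ 4)
          + 12 * ((frame g i l) ^ 2 * (frame g i k) ^ 2) := fun g => by ring
    simp only [hexp] at hsum
    have h22 : Integrable (fun g => 2 * (frame g i l) ^ 4 + 2 * (frame g i k) ^ 4) μ :=
      ((hint4 l).const_mul 2).add ((hint4 k).const_mul 2)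
    rw [integral_add h22 ((hint l k).const_mul 12),
      integral_add ((hint4 l).const_mul 2) ((hint4 k).const_mul 2), integral_const_mul,
      integral_const_mul, integral_const_mul, hcoord, hcoord] at hsum
    linarith
  -- Weakening the diagonal moments from m to m/3 makes all p² terms of E‖x‖⁴ = 1 at least m/3, so m
  -- ≤ 3/p².
  have hge : ∀ l k, m / 3 ≤ ∫ g, (frame g i l) ^ 2 * (frame g i k) ^ 2 ∂μ := fun l k => by
    by_cases hlk : l = k
    · subst hlk
      have h1 : ∀ g : Matrix.orthogonalGroup (Fin p) ℝ,
          (frame g i l) ^ 2 * (frame g i l) ^ 2 = (frame g i l) ^ 4 := fun g => by ring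
      simp only [h1, hcoord]
      linarith
    · exact (hmixed l k hlk).ge
  have htotal : ∑ l, ∑ k, ∫ g, (frame g i l) ^ 2 * (frame g i k) ^ 2 ∂μ = 1 := by
    have h1 : ∀ g : Matrix.orthogonalGroup (Fin p) ℝ,
        ∑ l, ∑ k, (frame g i l) ^ 2 * (frame g i k) ^ 2 = 1 := fun g => by
      rw [← Finset.sum_mul_sum, ← norm_sq_eq_sum, norm_frame]; norm_num
    have h2 : ∫ g, ∑ l, ∑ k, (frame g i l) ^ 2 * (frame g i k) ^ 2 ∂μ = 1 := by
      simp only [h1]; simp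
    rw [← h2, integral_finsetSum _ fun l _ => integrable_finsetSum _ fun k _ => hint l k]
    exact Finset.sum_congr rfl fun l _ => (integral_finsetSum _ fun k _ => hint l k).symm
  have hlow : ∑ _l : Fin p, ∑ _k : Fin p, m / 3 ≤ 1 := by
    rw [← htotal]
    exact Finset.sum_le_sum fun l _ => Finset.sum_le_sum fun k _ => hge l k
  simp only [Finset.sum_const, Finset.card_univ, Fintype.card_fin, nsmul_eq_mul] at hlow
  have hp : 0 < p := i.pos
  have hp0 : (0 : ℝ) < p := by exact_mod_cast hp
  rw [le_div_iff₀ (by positivity)]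
  linarith

end

section

variable {Ω : Type*} [MeasurableSpace Ω] {P : Measure Ω} [IsProbabilityMeasure P]

theorem lintegral_inner_frame_pow_four_le {p : ℕ} {ζ : Ω → Matrix.orthogonalGroup (Fin p) ℝ}
    (hζ : Measurable ζ) [(P.map ζ).IsMulLeftInvariant] (i : Fin p)
    {v : EuclideanSpace ℝ (Fin p)} (hv : ‖v‖ ≤ 1) :
    ∫⁻ ω, ENNReal.ofReal ((inner ℝ (frame (ζ ω) i) v) ^ 4) ∂P
      ≤ ENNReal.ofReal (3 / (p : ℝ) ^ 2) := by
  have : IsProbabilityMeasure (P.map ζ) := Measure.isProbabilityMeasure_map hζ.aemeasurable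
  have hm : Measurable fun g : Matrix.orthogonalGroup (Fin p) ℝ => (inner ℝ (frame g i) v) ^ 4 :=
    (Measurable.inner (𝕜 := ℝ) (measurable_frame i) measurable_const).pow_const 4
  have h1 : ∫⁻ ω, ENNReal.ofReal ((inner ℝ (frame (ζ ω) i) v) ^ 4) ∂P
      = ∫⁻ g, ENNReal.ofReal ((inner ℝ (frame g i) v) ^ 4) ∂(P.map ζ) :=
    (lintegral_map hm.ennreal_ofReal hζ).symm
  rw [h1, ← ofReal_integral_eq_lintegral_ofReal
    (integrable_of_frame _ (f := fun x => (inner ℝ x v) ^ 4) (by fun_prop) i)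
    (ae_of_all _ fun g => by positivity)]
  refine ENNReal.ofReal_le_ofReal ?_
  by_cases h0 : v = 0
  · simp only [h0, inner_zero_right]
    simp
    positivity
  have hn := norm_ne_zero_iff.2 h0
  have h2 := integral_inner_frame_pow_four_le (P.map ζ) i (v := ‖v‖⁻¹ • v)
    (by rw [norm_smul, norm_inv, norm_norm, inv_mul_cancel₀ hn])
  have h3 : ∀ g : Matrix.orthogonalGroup (Fin p) ℝ, inner ℝ (frame g i) v ^ 4
      = ‖v‖ ^ 4 * inner ℝ (frame g i) (‖v‖⁻¹ • v) ^ 4 := fun g => by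
    rw [inner_smul_right]
    field_simp
  simp only [h3]
  rw [integral_const_mul]
  exact (mul_le_of_le_one_left (integral_nonneg fun g => by positivity)
    (pow_le_one₀ (norm_nonneg _) hv)).trans h2

/-- The projections of independent random unit vectors onto Haar random subspaces tend to zero. -/
theorem ae_tendsto_starProjection_haar {T : ℕ → Type*} [∀ p, MeasurableSpace (T p)]
    {m : ℕ → ℕ} (hm : SquareRootDominated m)
    {ζ : (p : ℕ) → Ω → Matrix.orthogonalGroup (Fin p) ℝ} (hζ : ∀ p, Measurable (ζ p))
    (hHaar : ∀ p, (P.map (ζ p)).IsMulLeftInvariant) {f : (p : ℕ) → Ω → T p}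
    (hf : ∀ p, Measurable (f p)) (hind : ∀ p, IndepFun (ζ p) (f p) P)
    {v : (p : ℕ) → T p → EuclideanSpace ℝ (Fin p)} (hv : ∀ p, Measurable (v p))
    (hv1 : ∀ p t, ‖v p t‖ ≤ 1) :
    ∀ᵐ ω ∂P, Tendsto (fun p => ‖(subspaceOf (ζ p ω) (m p)).starProjection (v p (f p ω))‖) atTop
      (𝓝 0) := by
  have h1 := ae_tendsto_sum_sq_of_fourth_moment (P := P) hm (D := 3) (by norm_num)
    (x := fun p i ω => inner ℝ (frame (ζ p ω) i) (v p (f p ω)))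
    (fun p i => Measurable.inner (𝕜 := ℝ) ((measurable_frame i).comp (hζ p))
      ((hv p).comp (hf p)))
    (fun p i => lintegral_le_of_indepFun
      (F := fun t g => ENNReal.ofReal ((inner ℝ (frame g i) (v p t)) ^ 4)) (hf p) (hζ p)
      (hind p).symm
      ((Measurable.inner (𝕜 := ℝ) ((measurable_frame i).comp measurable_snd)
        ((hv p).comp measurable_fst)).pow_const 4).ennreal_ofReal
      fun t => by
        have := hHaar p
        exact lintegral_inner_frame_pow_four_le (hζ p) i (hv1 p t))
  filter_upwards [h1] with ω hω
  have h2 := hω.sqrt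
  rw [Real.sqrt_zero] at h2
  refine h2.congr fun p => ?_
  rw [← norm_sq_starProjection_subspaceOf, Real.sqrt_sq (norm_nonneg _)]

end

/-! ### Assembling the almost sure statement -/

theorem measurable_normalize_toLp (p : ℕ) :
    Measurable fun t : Fin p → ℝ => ‖WithLp.toLp 2 t‖⁻¹ • (WithLp.toLp 2 t : EuclideanSpace ℝ (Fin p)) := by
  have h : Measurable fun t : Fin p → ℝ => (WithLp.toLp 2 t : EuclideanSpace ℝ (Fin p)) :=
    WithLp.measurable_toLp 2 (Fin p → ℝ)
  exact h.norm.inv.smul h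

theorem theorem2p1 {Ω : Type*} [MeasurableSpace Ω] (P : Measure Ω) [IsProbabilityMeasure P]
    (n : ℕ) (hn : 2 ≤ n) (σ δ : ℝ) (hδ : 0 < δ)
    (β : ℕ → Ω → ℝ) (X : Fin n → Ω → ℝ) (Z : ℕ → Fin n → Ω → ℝ)
    (hβ : RegularBeta P β) (hind : JointlyIndependent P β X Z)
    (hX : RegularX P X σ) (hZ : RegularZ P Z δ)
    -- the data and the PCA estimator of the model with `p` assets
    (R : (p : ℕ) → Ω → Matrix (Fin p) (Fin n) ℝ)
    (hR : ∀ p ω, R p ω = returns (fun i => β i ω) (fun j => X j ω) (fun i j => Z i j ω) p)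
    (h : (p : ℕ) → Ω → EuclideanSpace ℝ (Fin p))
    (hh : ∀ p ω, 1 ≤ p → IsPCA (R p ω) (h p ω))
    (b : (p : ℕ) → Ω → EuclideanSpace ℝ (Fin p))
    (hb : ∀ p ω, b p ω = bVec (fun i => β i ω) p)
    -- the random subspaces `L p ω`, of dimension `k p`
    (k : ℕ → ℕ) (hk : SquareRootDominated k) (hkp : ∀ p, 2 ≤ p → k p ≤ p - 1)
    (ξ : (p : ℕ) → Ω → Matrix.orthogonalGroup (Fin p) ℝ) (hξ : ∀ p, Measurable (ξ p))
    (hξind : ∀ p, IndependentOfBetaZ P β Z (ξ p))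
    (L : (p : ℕ) → Ω → Submodule ℝ (EuclideanSpace ℝ (Fin p)))
    (hL : ∀ p ω, L p ω = subspaceOf (ξ p ω) (k p))
    -- the Haar random subspaces `H p ω`, of dimension `m p`
    (m : ℕ → ℕ) (hm : SquareRootDominated m) (hmp : ∀ p, 2 ≤ p → m p ≤ p - 1)
    (ζ : (p : ℕ) → Ω → Matrix.orthogonalGroup (Fin p) ℝ) (hζ : ∀ p, Measurable (ζ p))
    (hζHaar : ∀ p, (P.map (ζ p)).IsHaarMeasure)
    (hζind : ∀ p, IndependentOfBetaZ P β Z (ζ p))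
    (H : (p : ℕ) → Ω → Submodule ℝ (EuclideanSpace ℝ (Fin p)))
    (hH : ∀ p ω, H p ω = subspaceOf (ζ p ω) (m p)) :
    ∀ᵐ ω ∂P, (∃ j, X j ω ≠ 0) →
      ∃ errGPS errPCA : ℝ,
        Tendsto (fun p => ‖gps (R p ω) (h p ω) - b p ω‖) atTop (𝓝 errGPS) ∧
        Tendsto (fun p => ‖h p ω - b p ω‖) atTop (𝓝 errPCA) ∧
        limsup (fun p => ‖maps (R p ω) (h p ω) (L p ω ⊔ qSpan p) - b p ω‖) atTop ≤ errGPS ∧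
        Tendsto (fun p => ‖maps (R p ω) (h p ω) (H p ω ⊔ qSpan p) - b p ω‖) atTop (𝓝 errGPS) ∧
        Tendsto (fun p => ‖maps (R p ω) (h p ω) (H p ω) - b p ω‖) atTop (𝓝 errPCA) := by
  obtain rfl : R = fun p ω => returns (fun i => β i ω) (fun j => X j ω) (fun i j => Z i j ω) p :=
    funext fun p => funext fun ω => hR p ω
  obtain rfl : b = fun p ω => bVec (fun i => β i ω) p := funext fun p => funext fun ω => hb p ω
  obtain rfl : L = fun p ω => subspaceOf (ξ p ω) (k p) := funext fun p => funext fun ω => hL p ω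
  obtain rfl : H = fun p ω => subspaceOf (ζ p ω) (m p) := funext fun p => funext fun ω => hH p ω
  have hHaar : ∀ p, (P.map (ζ p)).IsMulLeftInvariant := fun p => (hζHaar p).toIsMulLeftInvariant
  have hHb := ae_tendsto_starProjection_haar hm hζ hHaar
    (f := fun p ω (i : Fin p) => β i ω) (fun p => measurable_pi_lambda _ fun i => hβ.measurable i)
    (fun p => (hζind p).beta) measurable_normalize_toLp (fun p t => by
      rw [norm_smul, norm_inv, norm_norm]
      exact inv_mul_le_one)
  -- Since q is deterministic, β is only a dummy argument here; at p = 0, where `norm_qVec` does not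
  -- apply, the vector is set to 0.
  have hHq := ae_tendsto_starProjection_haar hm hζ hHaar
    (f := fun p ω (i : Fin p) => β i ω) (fun p => measurable_pi_lambda _ fun i => hβ.measurable i)
    (fun p => (hζind p).beta) (v := fun p _ => if 1 ≤ p then qVec p else 0)
    (fun p => measurable_const) (fun p t => by
      split_ifs with hp
      · exact (norm_qVec hp).le
      · simp)
  filter_upwards [ae_limitLaws hβ hZ hind, hHb, hHq,
    ae_all_iff.2 fun j => ae_tendsto_starProjection_noise hZ hk hξ hξind j,
    ae_all_iff.2 fun j => ae_tendsto_starProjection_noise hZ hm hζ hζind j]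
    with ω ⟨B, μ, hl⟩ hb' hq' hLn hHn ⟨j, hj⟩
  refine hl.conclusion hδ hn (Function.ne_iff.2 ⟨j, hj⟩) (fun p hp => hh p ω hp) _ _ hLn hHn hb' ?_
  refine hq'.congr' ?_
  filter_upwards [eventually_ge_atTop 1] with p hp
  rw [if_pos hp]
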